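/- **Setting.** Let $\mathcal S,\mathcal O,\mathcal W,\mathcal A$ be standard Borel spaces (hidden states, observed states, reward proxies, actions). A time-homogeneous confounded POMDP consists of a transition kernel $\mathbf P(ds',do'\mid s,o,a)$, a uniformly bounded reward law given $(s,o,a)$ (in particular a bounded reward function), a proxy law $p_W(dw\mid s,o)$, a behavior policy $\pi^b(da\mid s,o)$ and a discount factor $\gamma\in[0,1)$. Let $T\in\mathbb N$. On a standard Borel probability space let $(S_t,O_t,W_t,A_t,R_t)_{t\ge 0}$ be random variables such that for $0\le t\le T$: $(S_{t+1},O_{t+1})$ has conditional law $\mathbf P$ given $(S_t,O_t,A_t)$, $A_t$ has conditional law $\pi^b$ given $(S_t,O_t)$, $R_t$ has the reward law given $(S_t,O_t,A_t)$; and for $0\le t\le T+1$, given $(S_t,O_t)$ and $\{S_j,O_j,A_j\}_{j<t}$, $W_t$ has conditional law $p_W(\cdot\mid S_t,O_t)$. Let $\pi(da\mid o)$ be a target policy. $\mathbb E_\pi[\,\cdot\mid\cdot\,]$ is the expectation over trajectories of the model started at the given value, with all actions not conditioned upon drawn from $\pi$; $J(\pi)=\mathbb E\big[\mathbb E_\pi[\sum_{k\ge0}\gamma^kR_k\mid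 S_0,O_0]\big]$. **Assumptions.** 1. (Markov) $(S_{t+1},O_{t+1})\perp\{S_j,O_j,A_j\}_{j<t}\mid(S_t,O_t,A_t)$ for $0\le t\le T$. 2. (Reward proxy) $W_t\perp(A_t,S_{t-1},O_{t-1})\mid(S_t,O_t)$ and $W_t\not\perp S_t\mid O_t$ for $1\le t\le T$; and $W_0\perp A_0\mid(S_0,O_0)$. 3. (Action proxy) $(O_{t-1},A_{t-1})\perp(W_t,R_t)\mid(S_t,O_t,A_t)$ for $1\le t\le T$. 4. (Completeness) For $1\le t\le T$ and almost every value $(o,a)$ of $(O_t,A_t)$, under the conditional law given $O_t=o,A_t=a$: (a) for every square-integrable $h(S_t)$, $\mathbb E[h(S_t)\mid O_{t-1},A_{t-1},O_t=o,A_t=a]=0$ a.s. iff $h(S_t)=0$ a.s.; (b) for every square-integrable $g(O_{t-1},A_{t-1})$, $\mathbb E[g(O_{t-1},A_{t-1})\mid O_t=o,W_t,A_t=a]=0$ a.s. iff $g(O_{t-1},A_{t-1})=0$ a.s. 5. (Regularity) For some $t_0$ with $1\le t_0\le T$ and some constant $C$: the law of $(S_t,O_t)$ is at most $C$ times the law of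 $(S_{t_0},O_{t_0})$ for all $0\le t\le T+1$; $\pi(\cdot\mid o)\le C\,\pi^b(\cdot\mid s,o)$ for almost every value $(s,o)$ of $(S_{t_0},O_{t_0})$; for almost every value $(o,a)$ of $(O_{t_0},A_{t_0})$ the operator $K_{o,a}f=\mathbb E[f(W_{t_0})\mid (O_{t_0-1},A_{t_0-1})=\cdot,\,O_{t_0}=o,A_{t_0}=a]$ from $L^2(W_{t_0}\mid o,a)$ to $L^2(O_{t_0-1},A_{t_0-1}\mid o,a)$ is compact; and there is $B$ with $\mathbb E|B(O_{t_0},A_{t_0})|<\infty$ such that for almost every $(o,a)$ every singular system $(\sigma_i,u_i,v_i)$ of $K_{o,a}$ satisfies $\sum_i\sigma_i^{-2}\langle\varphi_{o,a},v_i\rangle^2\le B(o,a)$, where, with $q^\pi(s,o,a)=\mathbb E_\pi[\sum_{k\ge0}\gamma^kR_{t+k}\mid S_t=s,O_t=o,A_t=a]$, $\varphi_{o,a}(z)=\mathbb E[q^\pi(S_{t_0},o,a)\mid (O_{t_0-1},A_{t_0-1})=z,O_{t_0}=o,A_{t_0}=a]$. **Definitions.** A measurable $Q:\mathcal O\times\mathcal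 W\times\mathcal A\to\mathbb R$ is a $Q$-bridge if, for $0\le t\le T$, $Q(O_t,W_t,A_t)$ is integrable and $$\mathbb E[Q(O_t,W_t,A_t)\mid O_t,S_t,A_t]=\mathbb E_\pi\Big[\sum_{k=0}^\infty\gamma^kR_{t+k}\,\Big|\,O_t,S_t,A_t\Big]\quad\text{a.s.}$$ A measurable $V:\mathcal O\times\mathcal W\to\mathbb R$ is a $V$-bridge if, for $0\le t\le T+1$, $V(O_t,W_t)$ is integrable and $$\mathbb E[V(O_t,W_t)\mid O_t,S_t]=\mathbb E_\pi\Big[\sum_{k=0}^\infty\gamma^kR_{t+k}\,\Big|\,O_t,S_t\Big]\quad\text{a.s.}$$ For $Q$ put $V_Q(o,w)=\int Q(o,w,a)\,\pi(da\mid o)$. The moment equation for $(Q,V)$ is: for $1\le t\le T$ the variable below is integrable and $$\mathbb E[Q(O_t,W_t,A_t)-R_t-\gamma V(O_{t+1},W_{t+1})\mid O_{t-1},A_{t-1},O_t,A_t]=0\quad\text{a.s.}\qquad(\ast)$$ **Theorem (Identification).** Under 1–5: (i) there are a $Q$-bridge $Q^\pi$, with $Q^\pi(O_t,W_t,A_t)$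 square-integrable for $0\le t\le T$, and a $V$-bridge $V^\pi=V_{Q^\pi}$ such that $(Q^\pi,V^\pi)$ solves $(\ast)$; (ii) $J(\pi)=\mathbb E[V(O_0,W_0)]$ for every $V$-bridge $V$; (iii) conversely, if $Q$ is measurable, $Q(O_t,W_t,A_t)$ is square-integrable for $0\le t\le T$, $\mathbb E[Q(O_t,W_t,A_t)\mid S_t,O_t,A_t]$ is a.s. bounded by a constant for $1\le t\le T$, and $(Q,V_Q)$ solves $(\ast)$, then $Q$ is a $Q$-bridge and $V_Q$ is a $V$-bridge. -/

import Mathlib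

open MeasureTheory ProbabilityTheory
open scoped ENNReal NNReal

noncomputable section

/-! ### Singular systems and the conditional expectation operator -/

/-- `(σ, u, v)` is a singular system of `K`: positive singular values, orthonormal singular vectors,
`K uᵢ = σᵢ vᵢ`, `K* vᵢ = σᵢ uᵢ`, and the `uᵢ` are total in the orthogonal complement of `ker K`. -/
structure IsSingularSystem {H₁ H₂ : Type*}
    [NormedAddCommGroup H₁] [InnerProductSpace ℝ H₁] [CompleteSpace H₁]
    [NormedAddCommGroup H₂] [InnerProductSpace ℝ H₂] [CompleteSpace H₂]
    (K : H₁ →L[ℝ] H₂) {ι : Type} (σ : ι → ℝ) (u : ι → H₁) (v : ι → H₂) : Prop where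
  pos : ∀ i, 0 < σ i
  orthonormal_left : Orthonormal ℝ u
  orthonormal_right : Orthonormal ℝ v
  map_left : ∀ i, K (u i) = σ i • v i
  map_right : ∀ i, ContinuousLinearMap.adjoint K (v i) = σ i • u i
  total : ∀ x, (∀ i, inner ℝ (u i) x = 0) → K x = 0

/-- The embedding `L²(law of X) → L²(τ)`, `f ↦ f(X)`. -/
def l2Embed {Ω 𝒳 : Type*} [MeasurableSpace Ω] [MeasurableSpace 𝒳] (τ : Measure Ω)
    (X : Ω → 𝒳) (hX : Measurable X) : Lp ℝ 2 (τ.map X) →L[ℝ] Lp ℝ 2 τ :=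
  (Lp.compMeasurePreservingₗᵢ ℝ X (hX.measurePreserving τ)).toContinuousLinearMap

/-- The conditional expectation operator `L²(law of X) → L²(law of Y)`, `f ↦ E[f(X) | Y = ·]`,
as the adjoint of the embedding `g ↦ g(Y)` applied to `f(X)`. -/
def condExpOp {Ω 𝒳 𝒴 : Type*} [MeasurableSpace Ω] [MeasurableSpace 𝒳] [MeasurableSpace 𝒴]
    (τ : Measure Ω) (X : Ω → 𝒳) (hX : Measurable X) (Y : Ω → 𝒴) (hY : Measurable Y) :
    Lp ℝ 2 (τ.map X) →L[ℝ] Lp ℝ 2 (τ.map Y) :=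
  (ContinuousLinearMap.adjoint (l2Embed τ Y hY)).comp (l2Embed τ X hX)

/-! ### The model and the values of a target policy -/

/-- A time-homogeneous confounded POMDP with hidden states `𝒮`, observed states `𝒪`, reward proxies
`𝒲` and actions `𝒜`. The reward may be random given `(s, o, a)`; a reward function is the case of
Dirac laws. -/
structure ConfoundedPOMDP (𝒮 𝒪 𝒲 𝒜 : Type*) [MeasurableSpace 𝒮] [MeasurableSpace 𝒪]
    [MeasurableSpace 𝒲] [MeasurableSpace 𝒜] where
  /-- law of the next full state given `(s, o, a)` -/
  trans : Kernel (𝒮 × 𝒪 × 𝒜) (𝒮 × 𝒪)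
  /-- law of the reward given `(s, o, a)` -/
  reward : Kernel (𝒮 × 𝒪 × 𝒜) ℝ
  /-- law of the reward proxy given `(s, o)` -/
  proxy : Kernel (𝒮 × 𝒪) 𝒲
  /-- behavior policy, which sees the hidden state -/
  behavior : Kernel (𝒮 × 𝒪) 𝒜
  /-- discount factor -/
  γ : ℝ
  markov_trans : IsMarkovKernel trans
  markov_reward : IsMarkovKernel reward
  markov_proxy : IsMarkovKernel proxy
  markov_behavior : IsMarkovKernel behavior
  γ_nonneg : 0 ≤ γ
  γ_lt_one : γ < 1
  reward_bounded : ∃ Rmax : ℝ, ∀ x, ∀ᵐ r ∂(reward x), |r| ≤ Rmax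

namespace ConfoundedPOMDP

attribute [instance] markov_trans markov_reward markov_proxy markov_behavior

variable {𝒮 𝒪 𝒲 𝒜 : Type*} [MeasurableSpace 𝒮] [MeasurableSpace 𝒪]
  [MeasurableSpace 𝒲] [MeasurableSpace 𝒜]

/-- Choose the action from the target policy: `(s, o) ↦` law of `(s, o, a)` with `a ∼ π(· | o)`. -/
def act (π : Kernel 𝒪 𝒜) : Kernel (𝒮 × 𝒪) (𝒮 × 𝒪 × 𝒜) :=
  (Kernel.id ×ₖ (π.comap Prod.snd measurable_snd)).map
    (fun x : (𝒮 × 𝒪) × 𝒜 => (x.1.1, x.1.2, x.2))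

instance (π : Kernel 𝒪 𝒜) [IsMarkovKernel π] : IsMarkovKernel (act (𝒮 := 𝒮) π) :=
  Kernel.IsMarkovKernel.map _ (by fun_prop)

/-- Draw the reward: `(s, o, a) ↦` law of `((s, o, a), r)`. -/
def earn (M : ConfoundedPOMDP 𝒮 𝒪 𝒲 𝒜) : Kernel (𝒮 × 𝒪 × 𝒜) ((𝒮 × 𝒪 × 𝒜) × ℝ) :=
  Kernel.id ×ₖ M.reward

instance (M : ConfoundedPOMDP 𝒮 𝒪 𝒲 𝒜) : IsMarkovKernel M.earn := by
  unfold earn; infer_instance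

/-- One step of the process `((S_k, O_k, A_k), R_k)` when actions follow the target policy. -/
def step (M : ConfoundedPOMDP 𝒮 𝒪 𝒲 𝒜) (π : Kernel 𝒪 𝒜) :
    Kernel ((𝒮 × 𝒪 × 𝒜) × ℝ) ((𝒮 × 𝒪 × 𝒜) × ℝ) :=
  (M.earn ∘ₖ act π ∘ₖ M.trans).comap Prod.fst measurable_fst

instance (M : ConfoundedPOMDP 𝒮 𝒪 𝒲 𝒜) (π : Kernel 𝒪 𝒜) [IsMarkovKernel π] :
    IsMarkovKernel (M.step π) := by
  unfold step; infer_instance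

/-- Law of the whole trajectory `((S_k, O_k, A_k), R_k)_{k ≥ 0}` started at `(s, o, a)`, with all
later actions drawn from the target policy. -/
def trajLaw (M : ConfoundedPOMDP 𝒮 𝒪 𝒲 𝒜) (π : Kernel 𝒪 𝒜) [IsMarkovKernel π] :
    Kernel (𝒮 × 𝒪 × 𝒜) (ℕ → (𝒮 × 𝒪 × 𝒜) × ℝ) :=
  Kernel.traj (X := fun _ => (𝒮 × 𝒪 × 𝒜) × ℝ)
      (fun n => (M.step π).comap (fun h => h ⟨n, Finset.mem_Iic.2 le_rfl⟩)
        (measurable_pi_apply _)) 0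
    ∘ₖ M.earn.map (fun x _ => x)

/-- Discounted return of a trajectory. -/
def ret (M : ConfoundedPOMDP 𝒮 𝒪 𝒲 𝒜) (τ : ℕ → (𝒮 × 𝒪 × 𝒜) × ℝ) : ℝ :=
  ∑' k, M.γ ^ k * (τ k).2

/-- `E_π[∑ γᵏ R_{t+k} | (S_t, O_t, A_t) = x]`. -/
def qValue (M : ConfoundedPOMDP 𝒮 𝒪 𝒲 𝒜) (π : Kernel 𝒪 𝒜) [IsMarkovKernel π]
    (x : 𝒮 × 𝒪 × 𝒜) : ℝ :=
  ∫ τ, M.ret τ ∂(M.trajLaw π x)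

/-- `E_π[∑ γᵏ R_{t+k} | (S_t, O_t) = x]`. -/
def vValue (M : ConfoundedPOMDP 𝒮 𝒪 𝒲 𝒜) (π : Kernel 𝒪 𝒜) [IsMarkovKernel π]
    (x : 𝒮 × 𝒪) : ℝ :=
  ∫ τ, M.ret τ ∂((M.trajLaw π ∘ₖ act π) x)

end ConfoundedPOMDP

/-! ### The data process -/

/-- The process of hidden states, observed states, proxies, actions and rewards. -/
structure DataProcess (Ω 𝒮 𝒪 𝒲 𝒜 : Type*) [MeasurableSpace Ω] [MeasurableSpace 𝒮]
    [MeasurableSpace 𝒪] [MeasurableSpace 𝒲] [MeasurableSpace 𝒜] where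
  S : ℕ → Ω → 𝒮
  O : ℕ → Ω → 𝒪
  W : ℕ → Ω → 𝒲
  A : ℕ → Ω → 𝒜
  R : ℕ → Ω → ℝ
  measurable_S : ∀ t, Measurable (S t)
  measurable_O : ∀ t, Measurable (O t)
  measurable_W : ∀ t, Measurable (W t)
  measurable_A : ∀ t, Measurable (A t)
  measurable_R : ∀ t, Measurable (R t)

namespace DataProcess

attribute [fun_prop] measurable_S measurable_O measurable_W measurable_A measurable_R

variable {Ω 𝒮 𝒪 𝒲 𝒜 : Type*} [MeasurableSpace Ω] [MeasurableSpace 𝒮]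
  [MeasurableSpace 𝒪] [MeasurableSpace 𝒲] [MeasurableSpace 𝒜]

/-- `(S_t, O_t)` -/
def SO (D : DataProcess Ω 𝒮 𝒪 𝒲 𝒜) (t : ℕ) (ω : Ω) : 𝒮 × 𝒪 := (D.S t ω, D.O t ω)

/-- `(S_t, O_t, A_t)` -/
def SOA (D : DataProcess Ω 𝒮 𝒪 𝒲 𝒜) (t : ℕ) (ω : Ω) : 𝒮 × 𝒪 × 𝒜 :=
  (D.S t ω, D.O t ω, D.A t ω)

/-- `(O_t, A_t)`; at time `t - 1` this is the action proxy of time `t`. -/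
def OA (D : DataProcess Ω 𝒮 𝒪 𝒲 𝒜) (t : ℕ) (ω : Ω) : 𝒪 × 𝒜 := (D.O t ω, D.A t ω)

/-- `(S_j, O_j, A_j)` for `j < t` -/
def past (D : DataProcess Ω 𝒮 𝒪 𝒲 𝒜) (t : ℕ) (ω : Ω) : Fin t → 𝒮 × 𝒪 × 𝒜 :=
  fun j => D.SOA j ω

lemma measurable_SO (D : DataProcess Ω 𝒮 𝒪 𝒲 𝒜) (t : ℕ) : Measurable (D.SO t) :=
  (D.measurable_S t).prodMk (D.measurable_O t)

lemma measurable_OA (D : DataProcess Ω 𝒮 𝒪 𝒲 𝒜) (t : ℕ) : Measurable (D.OA t) :=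
  (D.measurable_O t).prodMk (D.measurable_A t)

lemma measurable_SOA (D : DataProcess Ω 𝒮 𝒪 𝒲 𝒜) (t : ℕ) : Measurable (D.SOA t) :=
  (D.measurable_S t).prodMk (D.measurable_OA t)

/-- The data up to time `T` (and the state and proxy of time `T + 1`) are generated by the model
under its behavior policy; the proxy `W_t` has no parents other than `(S_t, O_t)`. -/
structure GeneratedBy (D : DataProcess Ω 𝒮 𝒪 𝒲 𝒜) (μ : Measure Ω)
    (M : ConfoundedPOMDP 𝒮 𝒪 𝒲 𝒜) (T : ℕ) : Prop where
  state : ∀ t ≤ T, HasCondDistrib (D.SO (t + 1)) (D.SOA t) M.trans μ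
  action : ∀ t ≤ T, HasCondDistrib (D.A t) (D.SO t) M.behavior μ
  reward : ∀ t ≤ T, HasCondDistrib (D.R t) (D.SOA t) M.reward μ
  proxy : ∀ t ≤ T + 1, HasCondDistrib (D.W t) (fun ω => (D.past t ω, D.SO t ω))
    (Kernel.prodMkLeft (Fin t → 𝒮 × 𝒪 × 𝒜) M.proxy) μ

/-- Markov assumption. -/
def Markovian [StandardBorelSpace Ω] (D : DataProcess Ω 𝒮 𝒪 𝒲 𝒜) (μ : Measure Ω)
    [IsFiniteMeasure μ] (T : ℕ) : Prop :=
  ∀ t ≤ T, D.SO (t + 1) ⟂ᵢ[D.SOA t, D.measurable_SOA t; μ] D.past t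

/-- Reward proxy assumption (with its obvious analogue at time `0`). -/
structure RewardProxy [StandardBorelSpace Ω] (D : DataProcess Ω 𝒮 𝒪 𝒲 𝒜) (μ : Measure Ω)
    [IsFiniteMeasure μ] (T : ℕ) : Prop where
  indep_zero : D.W 0 ⟂ᵢ[D.SO 0, D.measurable_SO 0; μ] D.A 0
  indep : ∀ t, 1 ≤ t → t ≤ T →
    D.W t ⟂ᵢ[D.SO t, D.measurable_SO t; μ] (fun ω => (D.A t ω, D.SO (t - 1) ω))
  relevant : ∀ t, 1 ≤ t → t ≤ T → ¬ (D.W t ⟂ᵢ[D.O t, D.measurable_O t; μ] D.S t)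

/-- Action proxy assumption. -/
def ActionProxy [StandardBorelSpace Ω] (D : DataProcess Ω 𝒮 𝒪 𝒲 𝒜) (μ : Measure Ω)
    [IsFiniteMeasure μ] (T : ℕ) : Prop :=
  ∀ t, 1 ≤ t → t ≤ T →
    D.OA (t - 1) ⟂ᵢ[D.SOA t, D.measurable_SOA t; μ] (fun ω => (D.W t ω, D.R t ω))

/-- The regular conditional probability given `(O_t, A_t) = (o, a)`. -/
def fiber [StandardBorelSpace Ω] [Nonempty Ω] (D : DataProcess Ω 𝒮 𝒪 𝒲 𝒜) (μ : Measure Ω)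
    [IsFiniteMeasure μ] (t : ℕ) (oa : 𝒪 × 𝒜) : Measure Ω :=
  condDistrib id (D.OA t) μ oa

/-- Completeness assumption, at almost every value `(o, a)` of `(O_t, A_t)`. -/
structure Complete [StandardBorelSpace Ω] [Nonempty Ω] (D : DataProcess Ω 𝒮 𝒪 𝒲 𝒜)
    (μ : Measure Ω) [IsFiniteMeasure μ] (T : ℕ) : Prop where
  /-- `E[h(S_t) | O_{t-1}, A_{t-1}, O_t = o, A_t = a] = 0` iff `h = 0` -/
  state : ∀ t, 1 ≤ t → t ≤ T → ∀ᵐ oa ∂(μ.map (D.OA t)), ∀ h : 𝒮 → ℝ, Measurable h →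
    MemLp (fun ω => h (D.S t ω)) 2 (D.fiber μ t oa) →
    ((D.fiber μ t oa)[fun ω => h (D.S t ω) |
        MeasurableSpace.comap (D.OA (t - 1)) inferInstance] =ᵐ[D.fiber μ t oa] 0 ↔
      (fun ω => h (D.S t ω)) =ᵐ[D.fiber μ t oa] 0)
  /-- `E[g(O_{t-1}, A_{t-1}) | O_t = o, W_t, A_t = a] = 0` iff `g = 0` -/
  proxy : ∀ t, 1 ≤ t → t ≤ T → ∀ᵐ oa ∂(μ.map (D.OA t)), ∀ g : 𝒪 × 𝒜 → ℝ, Measurable g →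
    MemLp (fun ω => g (D.OA (t - 1) ω)) 2 (D.fiber μ t oa) →
    ((D.fiber μ t oa)[fun ω => g (D.OA (t - 1) ω) |
        MeasurableSpace.comap (D.W t) inferInstance] =ᵐ[D.fiber μ t oa] 0 ↔
      (fun ω => g (D.OA (t - 1) ω)) =ᵐ[D.fiber μ t oa] 0)

/-- The operator `f ↦ E[f(W_t) | (O_{t-1}, A_{t-1}) = ·, O_t = o, A_t = a]` from
`L²(W_t | o, a)` to `L²(O_{t-1}, A_{t-1} | o, a)`. -/
def bridgeOp [StandardBorelSpace Ω] [Nonempty Ω] (D : DataProcess Ω 𝒮 𝒪 𝒲 𝒜)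
    (μ : Measure Ω) [IsFiniteMeasure μ] (t : ℕ) (oa : 𝒪 × 𝒜) :
    Lp ℝ 2 ((D.fiber μ t oa).map (D.W t)) →L[ℝ] Lp ℝ 2 ((D.fiber μ t oa).map (D.OA (t - 1))) :=
  condExpOp (D.fiber μ t oa) (D.W t) (D.measurable_W t) (D.OA (t - 1)) (D.measurable_OA (t - 1))

/-- The inner product in `L²(O_{t-1}, A_{t-1} | o, a)` of `v` with the function
`z ↦ E_μ[ E_π[∑ γᵏ R_{t+k} | S_t, O_t, A_t] | (O_{t-1}, A_{t-1}) = z, O_t = o, A_t = a]`. -/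
def targetCoeff [StandardBorelSpace Ω] [Nonempty Ω] (D : DataProcess Ω 𝒮 𝒪 𝒲 𝒜)
    (μ : Measure Ω) [IsFiniteMeasure μ] (M : ConfoundedPOMDP 𝒮 𝒪 𝒲 𝒜) (π : Kernel 𝒪 𝒜)
    [IsMarkovKernel π] (t : ℕ) (oa : 𝒪 × 𝒜) (v : 𝒪 × 𝒜 → ℝ) : ℝ :=
  ∫ ω, ((D.fiber μ t oa)[fun ω' => M.qValue π (D.S t ω', oa) |
      MeasurableSpace.comap (D.OA (t - 1)) inferInstance]) ω * v (D.OA (t - 1) ω)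
    ∂(D.fiber μ t oa)

/-- Regularity conditions: at one time `t₀` of the data, whose state law covers the state laws of
all other times and where the behavior policy covers the target policy, the conditional expectation
operators are compact and the Picard series of the target are integrable. -/
def Regular [StandardBorelSpace Ω] [Nonempty Ω] (D : DataProcess Ω 𝒮 𝒪 𝒲 𝒜)
    (μ : Measure Ω) [IsFiniteMeasure μ] (M : ConfoundedPOMDP 𝒮 𝒪 𝒲 𝒜) (π : Kernel 𝒪 𝒜)
    [IsMarkovKernel π] (T : ℕ) : Prop :=
  ∃ t₀, 1 ≤ t₀ ∧ t₀ ≤ T ∧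
    (∃ C : ℝ≥0, ∀ t ≤ T + 1, μ.map (D.SO t) ≤ C • μ.map (D.SO t₀)) ∧
    (∃ C : ℝ≥0, ∀ᵐ x ∂(μ.map (D.SO t₀)), π x.2 ≤ C • M.behavior x) ∧
    (∀ᵐ oa ∂(μ.map (D.OA t₀)), IsCompactOperator (D.bridgeOp μ t₀ oa)) ∧
    ∃ B : 𝒪 × 𝒜 → ℝ, Integrable B (μ.map (D.OA t₀)) ∧
      ∀ᵐ oa ∂(μ.map (D.OA t₀)), ∀ (ι : Type) (σ : ι → ℝ)
        (u : ι → Lp ℝ 2 ((D.fiber μ t₀ oa).map (D.W t₀)))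
        (v : ι → Lp ℝ 2 ((D.fiber μ t₀ oa).map (D.OA (t₀ - 1)))),
        IsSingularSystem (D.bridgeOp μ t₀ oa) σ u v →
          Summable (fun i => (D.targetCoeff μ M π t₀ oa (v i) / σ i) ^ 2) ∧
          ∑' i, (D.targetCoeff μ M π t₀ oa (v i) / σ i) ^ 2 ≤ B oa

/-! ### Bridge functions -/

/-- `Q` is a `Q`-bridge function of `π`. -/
def IsQBridge (D : DataProcess Ω 𝒮 𝒪 𝒲 𝒜) (μ : Measure Ω) (M : ConfoundedPOMDP 𝒮 𝒪 𝒲 𝒜)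
    (π : Kernel 𝒪 𝒜) [IsMarkovKernel π] (T : ℕ) (Q : 𝒪 × 𝒲 × 𝒜 → ℝ) : Prop :=
  Measurable Q ∧ ∀ t ≤ T,
    Integrable (fun ω => Q (D.O t ω, D.W t ω, D.A t ω)) μ ∧
    μ[fun ω => Q (D.O t ω, D.W t ω, D.A t ω) | MeasurableSpace.comap (D.SOA t) inferInstance]
      =ᵐ[μ] fun ω => M.qValue π (D.SOA t ω)

/-- `V` is a `V`-bridge function of `π`. -/
def IsVBridge (D : DataProcess Ω 𝒮 𝒪 𝒲 𝒜) (μ : Measure Ω) (M : ConfoundedPOMDP 𝒮 𝒪 𝒲 𝒜)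
    (π : Kernel 𝒪 𝒜) [IsMarkovKernel π] (T : ℕ) (V : 𝒪 × 𝒲 → ℝ) : Prop :=
  Measurable V ∧ ∀ t ≤ T + 1,
    Integrable (fun ω => V (D.O t ω, D.W t ω)) μ ∧
    μ[fun ω => V (D.O t ω, D.W t ω) | MeasurableSpace.comap (D.SO t) inferInstance]
      =ᵐ[μ] fun ω => M.vValue π (D.SO t ω)

/-- The conditional moment equation
`E[Q(O_t, W_t, A_t) - R_t - γ V(O_{t+1}, W_{t+1}) | O_{t-1}, A_{t-1}, O_t, A_t] = 0`. -/
def SolvesMomentEquation (D : DataProcess Ω 𝒮 𝒪 𝒲 𝒜) (μ : Measure Ω) (γ : ℝ) (T : ℕ)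
    (Q : 𝒪 × 𝒲 × 𝒜 → ℝ) (V : 𝒪 × 𝒲 → ℝ) : Prop :=
  ∀ t, 1 ≤ t → t ≤ T →
    Integrable (fun ω => Q (D.O t ω, D.W t ω, D.A t ω) - D.R t ω
      - γ * V (D.O (t + 1) ω, D.W (t + 1) ω)) μ ∧
    μ[fun ω => Q (D.O t ω, D.W t ω, D.A t ω) - D.R t ω - γ * V (D.O (t + 1) ω, D.W (t + 1) ω) |
      MeasurableSpace.comap (fun ω => (D.OA (t - 1) ω, D.OA t ω)) inferInstance] =ᵐ[μ] 0

/-- The policy value `J(π) = E[E_π[∑ γᵏ R_k | S_0, O_0]]`. -/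
def policyValue (D : DataProcess Ω 𝒮 𝒪 𝒲 𝒜) (μ : Measure Ω) (M : ConfoundedPOMDP 𝒮 𝒪 𝒲 𝒜)
    (π : Kernel 𝒪 𝒜) [IsMarkovKernel π] : ℝ :=
  ∫ ω, M.vValue π (D.SO 0 ω) ∂μ

end DataProcess

/-- `o, w ↦ ∫ Q(o, w, a) π(da | o)` -/
def policyAverage {𝒪 𝒲 𝒜 : Type*} [MeasurableSpace 𝒪] [MeasurableSpace 𝒜]
    (π : Kernel 𝒪 𝒜) (Q : 𝒪 × 𝒲 × 𝒜 → ℝ) (x : 𝒪 × 𝒲) : ℝ :=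
  ∫ a, Q (x.1, x.2, a) ∂(π x.1)

end

/-! Write `b(s,o,a)` for the mean of `Q(o,·,a)` under the proxy law (`proxyMean`). Since the proxy
depends only on the current state, `Q` is a bridge exactly when `b` equals `qValue` almost surely
along the data. The argument works at the single time `t₀`. Coverage carries null sets and
integrability from `t₀` to all other times, and to actions drawn from `π` (`Covered.isBridge`).

Existence. It suffices to solve `E[Q - q | O_{t₀-1}, A_{t₀-1}, O_{t₀}, A_{t₀}] = 0`, because
completeness in the hidden state then forces `b = q`. In a fibre `(o,a)` the equation reads `K f =
φ`. The Picard bound, together with injectivity of `K*` (completeness in the proxy), is used in the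
dual form `⟪φ,g⟫² ≤ B ‖K* g‖²` (`IsSingularSystem.sq_inner_le`). Unlike fibrewise solutions, whose
joint measurability would have to be proved, these inequalities can be integrated over `(o,a)`. By
Cauchy–Schwarz they bound the functional `g ↦ E[q g]` by the norm of the global conditional
expectation operator applied to `g`. Hahn–Banach and Riesz then give one square-integrable function
of `(O,A,W)` solving all the fibres together (`exists_condExp_sub_eq_zero`).

Moment equation. Condition first on the finer variable `(S_t,O_t,A_t,O_{t-1},A_{t-1})`. The
conditional independences turn the observable residual into the Bellman residual of `b`
(`Covered.condExp_residual`). For `b = q` this vanishes by the Bellman equation. Conversely, if its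
observable conditional expectation vanishes, then completeness in the hidden state makes the
residual itself vanish. A bounded `b` satisfying the Bellman equation equals `q`, because the
Bellman operator is a `γ`-contraction in the sup norm (`Covered.ae_eq_qValue_of_bellman`).

The policy value formula is the tower property at time `0`. -/

/-! ### Singular systems and ranges of bounded operators -/

section Hilbert

variable {H₁ H₂ : Type*}
  [NormedAddCommGroup H₁] [InnerProductSpace ℝ H₁] [CompleteSpace H₁]
  [NormedAddCommGroup H₂] [InnerProductSpace ℝ H₂] [CompleteSpace H₂]

/-- Every compact operator between real Hilbert spaces has a singular system. -/
theorem IsCompactOperator.exists_isSingularSystem {K : H₁ →L[ℝ] H₂} (hK : IsCompactOperator K) :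
    ∃ (ι : Type) (σ : ι → ℝ) (u : ι → H₁) (v : ι → H₂), IsSingularSystem K σ u v := by
  -- Spectral theorem for `K*K`: `u` runs through orthonormal bases of the eigenspaces with nonzero
  -- eigenvalue `λ`, with `σ = √λ` and `v = K u / σ`.
  set T : H₁ →L[ℝ] H₁ := (ContinuousLinearMap.adjoint K).comp K with hTdef
  have hT : IsCompactOperator T := hK.clm_comp (ContinuousLinearMap.adjoint K)
  have hinner : ∀ x y, inner ℝ (T x) y = inner ℝ (K x) (K y) := fun x y => by
    simp [hTdef, ContinuousLinearMap.adjoint_inner_left]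
  have hsymm : T.IsSymmetric := fun x y => by
    rw [ContinuousLinearMap.coe_coe, hinner, real_inner_comm (T y) x,
      hinner, real_inner_comm]
  have hfin : ∀ c : {x : ℝ // x ≠ 0}, FiniteDimensional ℝ
      (Module.End.eigenspace T.toLinearMap c.1) := fun c =>
    ContinuousLinearMap.finite_dimensional_eigenspace hT c.1 c.2
  let b : ∀ c : {x : ℝ // x ≠ 0},
      OrthonormalBasis (Fin (Module.finrank ℝ (Module.End.eigenspace T.toLinearMap c.1))) ℝ
        (Module.End.eigenspace T.toLinearMap c.1) := fun c => stdOrthonormalBasis ℝ _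
  let ι : Type := Σ c : {x : ℝ // x ≠ 0}, Fin (Module.finrank ℝ
      (Module.End.eigenspace T.toLinearMap c.1))
  let u : ι → H₁ := fun i => (b i.1 i.2 : H₁)
  have hfam : OrthogonalFamily ℝ
      (fun c : {x : ℝ // x ≠ 0} => Module.End.eigenspace T.toLinearMap c.1)
      (fun c => (Module.End.eigenspace T.toLinearMap c.1).subtypeₗᵢ) :=
    hsymm.orthogonalFamily_eigenspaces.comp Subtype.val_injective
  have hu : Orthonormal ℝ u :=
    hfam.orthonormal_sigma_orthonormal (fun c => (b c).orthonormal)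
  have hTu : ∀ i : ι, T (u i) = i.1.1 • u i := fun i =>
    Module.End.mem_eigenspace_iff.1 (b i.1 i.2).2
  have hKu : ∀ i j : ι, inner ℝ (K (u i)) (K (u j)) = i.1.1 * inner ℝ (u i) (u j) := fun i j => by
    rw [← hinner, hTu, real_inner_smul_left]
  have hpos : ∀ i : ι, 0 < (i.1.1 : ℝ) := fun i => by
    have h := hKu i i
    rw [real_inner_self_eq_norm_sq, real_inner_self_eq_norm_sq, hu.1 i] at h
    have : 0 ≤ (i.1.1 : ℝ) := by nlinarith [sq_nonneg ‖K (u i)‖]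
    exact lt_of_le_of_ne this (Ne.symm i.1.2)
  have hsq : ∀ i : ι, 0 < √(i.1.1 : ℝ) := fun i => Real.sqrt_pos.2 (hpos i)
  refine ⟨ι, fun i => √(i.1.1 : ℝ), u, fun i => (√(i.1.1 : ℝ))⁻¹ • K (u i),
    ⟨hsq, hu, ?_, ?_, ?_, ?_⟩⟩
  · classical
    rw [orthonormal_iff_ite] at hu ⊢
    intro i j
    rw [real_inner_smul_left, real_inner_smul_right, hKu, hu]
    split_ifs with h
    · subst h
      rw [mul_one, ← mul_assoc, ← mul_inv, Real.mul_self_sqrt (hpos i).le,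
        inv_mul_cancel₀ (hpos i).ne']
    · simp
  · intro i
    rw [smul_smul, mul_inv_cancel₀ (hsq i).ne', one_smul]
  · intro i
    have : ContinuousLinearMap.adjoint K (K (u i)) = i.1.1 • u i := hTu i
    rw [map_smul, this, smul_smul]
    congr 1
    rw [inv_mul_eq_div, Real.div_sqrt]
  · intro x hx
    have hxc : ∀ c : {x : ℝ // x ≠ 0}, ∀ e ∈ Module.End.eigenspace T.toLinearMap c.1,
        inner ℝ e x = 0 := by
      intro c e he
      have he' : e = ∑ i, ((b c).repr ⟨e, he⟩ i) • (b c i : H₁) := by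
        have h := congrArg Subtype.val ((b c).sum_repr ⟨e, he⟩)
        simpa using h.symm
      rw [he', sum_inner]
      refine Finset.sum_eq_zero fun i _ => ?_
      rw [real_inner_smul_left, hx ⟨c, i⟩, mul_zero]
    -- `T x` is orthogonal to every eigenspace: for nonzero eigenvalues because `x` is, and for
    -- eigenvalue `0` because `⟪e, T x⟫ = ⟪T e, x⟫ = 0`. Hence `T x = 0`, and `‖K x‖² = ⟪T x, x⟫ =
    -- 0`.
    have hTx : T x ∈ (⨆ c, Module.End.eigenspace T.toLinearMap c)ᗮ := by
      rw [Submodule.mem_orthogonal]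
      intro e he
      refine Submodule.iSup_induction _ (motive := fun e => inner ℝ e (T x) = 0) he ?_ ?_ ?_
      · intro c e he
        have h1 : inner ℝ e (T x) = inner ℝ (T e) x := (hsymm e x).symm
        have h2 : T e = c • e := Module.End.mem_eigenspace_iff.1 he
        rw [h1, h2, real_inner_smul_left]
        by_cases hc : c = 0
        · simp [hc]
        · rw [hxc ⟨c, hc⟩ e he, mul_zero]
      · simp
      · intro e f he hf
        rw [inner_add_left, he, hf, add_zero]
    rw [ContinuousLinearMap.orthogonalComplement_iSup_eigenspaces_eq_bot hT hsymm,
      Submodule.mem_bot] at hTx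
    have h := hinner x x
    rw [hTx, inner_zero_left] at h
    exact inner_self_eq_zero.1 h.symm

/-- If the adjoint is injective and the Picard series of `φ` is bounded by `B`, then
`⟪φ, g⟫² ≤ B ‖K* g‖²`. -/
theorem IsSingularSystem.sq_inner_le {K : H₁ →L[ℝ] H₂} {ι : Type} {σ : ι → ℝ} {u : ι → H₁}
    {v : ι → H₂} (h : IsSingularSystem K σ u v)
    (hker : ∀ g, ContinuousLinearMap.adjoint K g = 0 → g = 0) {φ : H₂} {B : ℝ}
    (hs : Summable fun i => (inner ℝ φ (v i) / σ i) ^ 2)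
    (hB : ∑' i, (inner ℝ φ (v i) / σ i) ^ 2 ≤ B) (g : H₂) :
    inner ℝ φ g ^ 2 ≤ B * ‖ContinuousLinearMap.adjoint K g‖ ^ 2 := by
  have hu : ∀ i, inner ℝ (u i) (ContinuousLinearMap.adjoint K g) = σ i * inner ℝ (v i) g :=
    fun i => by rw [ContinuousLinearMap.adjoint_inner_right, h.map_left, real_inner_smul_left]
  -- If `x` is orthogonal to all `v i`, then `K* x` is orthogonal to all `u i`, so `K K* x = 0`,
  -- hence `K* x = 0`, and injectivity gives `x = 0`. The `v i` therefore form a Hilbert basis.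
  have htot : (Submodule.span ℝ (Set.range v))ᗮ = ⊥ := by
    rw [Submodule.eq_bot_iff]
    intro x hx
    have hvx : ∀ i, inner ℝ (v i) x = 0 := fun i =>
      (Submodule.mem_orthogonal _ _).1 hx _ (Submodule.subset_span ⟨i, rfl⟩)
    have h1 : K (ContinuousLinearMap.adjoint K x) = 0 := h.total _ fun i => by
      rw [ContinuousLinearMap.adjoint_inner_right, h.map_left, real_inner_smul_left, hvx, mul_zero]
    refine hker x ?_
    have h2 : inner ℝ (ContinuousLinearMap.adjoint K x) (ContinuousLinearMap.adjoint K x) = 0 := by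
      rw [ContinuousLinearMap.adjoint_inner_left, h1, inner_zero_right]
    exact inner_self_eq_zero.1 h2
  let b : HilbertBasis ι ℝ H₂ := HilbertBasis.mkOfOrthogonalEqBot h.orthonormal_right htot
  have hb : ∀ i, b i = v i := fun i => by simp [b]
  have hsum : HasSum (fun i => inner ℝ φ (v i) * inner ℝ (v i) g) (inner ℝ φ g) := by
    simpa [hb] using b.hasSum_inner_mul_inner φ g
  set G := ContinuousLinearMap.adjoint K g
  have hterm : ∀ i, inner ℝ φ (v i) * inner ℝ (v i) g
      = (inner ℝ φ (v i) / σ i) * inner ℝ (u i) G := fun i => by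
    rw [hu]; field_simp [(h.pos i).ne']
  simp_rw [hterm] at hsum
  -- Cauchy–Schwarz on partial sums: the first factor is the Picard series, the second is controlled
  -- by Bessel's inequality for `u`.
  have hfin : ∀ s : Finset ι, (∑ i ∈ s, (inner ℝ φ (v i) / σ i) * inner ℝ (u i) G) ^ 2
      ≤ B * ‖G‖ ^ 2 := fun s => by
    refine (Finset.sum_mul_sq_le_sq_mul_sq s _ _).trans ?_
    refine mul_le_mul ((hs.sum_le_tsum s fun i _ => sq_nonneg _).trans hB) ?_
      (Finset.sum_nonneg fun i _ => sq_nonneg _) ((tsum_nonneg fun i => sq_nonneg _).trans hB)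
    simpa using h.orthonormal_left.sum_inner_products_le (x := G) (s := s)
  exact le_of_tendsto (hsum.pow 2) (Filter.Eventually.of_forall hfin)

/-- A linear functional dominated by `‖A ·‖` is represented through `A`. -/
theorem ContinuousLinearMap.exists_inner_apply_eq {E : Type*} [NormedAddCommGroup E]
    [NormedSpace ℝ E] {A : E →L[ℝ] H₁} {ℓ : E →ₗ[ℝ] ℝ} {c : ℝ}
    (h : ∀ g, |ℓ g| ≤ c * ‖A g‖) : ∃ f : H₁, ∀ g, inner ℝ f (A g) = ℓ g := by
  -- A merely linear section `s` of `A` over its range suffices: the hypothesis makes `ℓ ∘ s`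
  -- bounded, since `A (s y) = y`. Hahn–Banach then extends it from the range, which need not be
  -- closed, and Riesz represents the extension.
  obtain ⟨s, hs⟩ := A.toLinearMap.rangeRestrict.exists_rightInverse_of_surjective
    A.toLinearMap.range_rangeRestrict
  have hs' : ∀ y : A.toLinearMap.range, A (s y) = y := fun y =>
    congrArg Subtype.val (LinearMap.congr_fun hs y)
  let ℓ' : StrongDual ℝ A.toLinearMap.range := (ℓ.comp s).mkContinuous c fun y => by
    have := h (s y)
    rwa [hs' y] at this
  obtain ⟨L, hL, -⟩ := exists_extension_norm_eq _ ℓ'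
  refine ⟨(InnerProductSpace.toDual ℝ H₁).symm L, fun g => ?_⟩
  rw [InnerProductSpace.toDual_symm_apply]
  have h1 := hL ⟨A g, g, rfl⟩
  simp only at h1
  rw [h1]
  change ℓ (s _) = ℓ g
  -- The choice of section does not matter, as `ℓ` vanishes on `ker A`.
  have h2 := h (s ⟨A g, g, rfl⟩ - g)
  rw [map_sub A, hs', sub_self, norm_zero, mul_zero, map_sub] at h2
  exact sub_eq_zero.1 (abs_nonpos_iff.1 h2)

end Hilbert

/-! ### The conditional expectation operator -/

section CondExpOp

variable {Ω 𝒳 𝒴 : Type*} [MeasurableSpace Ω] [MeasurableSpace 𝒳] [MeasurableSpace 𝒴]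
  {τ : Measure Ω} {X : Ω → 𝒳} {Y : Ω → 𝒴}

theorem l2Embed_ae_eq (hX : Measurable X) (f : Lp ℝ 2 (τ.map X)) :
    l2Embed τ X hX f =ᵐ[τ] fun ω => f (X ω) :=
  Lp.coeFn_compMeasurePreserving f (hX.measurePreserving τ)

theorem norm_l2Embed (hX : Measurable X) (f : Lp ℝ 2 (τ.map X)) : ‖l2Embed τ X hX f‖ = ‖f‖ :=
  (Lp.compMeasurePreservingₗᵢ ℝ X (hX.measurePreserving τ)).norm_map f

theorem inner_l2Embed (hX : Measurable X) (f g : Lp ℝ 2 (τ.map X)) :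
    inner ℝ (l2Embed τ X hX f) (l2Embed τ X hX g) = inner ℝ f g :=
  (Lp.compMeasurePreservingₗᵢ ℝ X (hX.measurePreserving τ)).inner_map_map f g

/-- This symmetry turns completeness in the proxy, a statement on conditioning on `W`, into
injectivity of the adjoint of `bridgeOp`. -/
theorem adjoint_condExpOp (hX : Measurable X) (hY : Measurable Y) :
    ContinuousLinearMap.adjoint (condExpOp τ X hX Y hY) = condExpOp τ Y hY X hX := by
  rw [condExpOp, ContinuousLinearMap.adjoint_comp, ContinuousLinearMap.adjoint_adjoint, condExpOp]

theorem inner_condExpOp (hX : Measurable X) (hY : Measurable Y) (f : Lp ℝ 2 (τ.map X))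
    (g : Lp ℝ 2 (τ.map Y)) :
    inner ℝ g (condExpOp τ X hX Y hY f) = ∫ ω, g (Y ω) * f (X ω) ∂τ := by
  rw [condExpOp, ContinuousLinearMap.comp_apply, ContinuousLinearMap.adjoint_inner_right,
    L2.inner_def]
  refine integral_congr_ae ?_
  filter_upwards [l2Embed_ae_eq hX f, l2Embed_ae_eq hY g] with ω h1 h2
  rw [h1, h2]
  simp [mul_comm]

theorem integrable_lp_comp [IsFiniteMeasure τ] (hX : Measurable X) (f : Lp ℝ 2 (τ.map X)) :
    Integrable (fun ω => f (X ω)) τ :=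
  ((Lp.memLp f).comp_measurePreserving (hX.measurePreserving τ)).integrable one_le_two

theorem setIntegral_condExpOp [IsFiniteMeasure τ] (hX : Measurable X) (hY : Measurable Y)
    (f : Lp ℝ 2 (τ.map X)) {t : Set 𝒴} (ht : MeasurableSet t) :
    ∫ ω in Y ⁻¹' t, condExpOp τ X hX Y hY f (Y ω) ∂τ = ∫ ω in Y ⁻¹' t, f (X ω) ∂τ := by
  have h := inner_condExpOp hX hY f
    (indicatorConstLp 2 ht (measure_ne_top (τ.map Y) t) (1 : ℝ))
  rw [L2.inner_indicatorConstLp_one] at h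
  rw [← setIntegral_map ht (Lp.aestronglyMeasurable _) hY.aemeasurable, h,
    ← integral_indicator (hY ht)]
  refine integral_congr_ae ?_
  have hind : ∀ᵐ y ∂(τ.map Y), indicatorConstLp 2 ht (measure_ne_top (τ.map Y) t) (1 : ℝ) y
      = t.indicator (fun _ => (1 : ℝ)) y := indicatorConstLp_coeFn
  filter_upwards [ae_of_ae_map hY.aemeasurable hind] with ω hω
  rw [hω]
  by_cases hm : Y ω ∈ t
  · simp [hm]
  · simp [hm]

/-- Pairing the adjoint with indicators yields the set integrals that characterise a conditional
expectation, so the abstract operator is the probabilistic one. -/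
theorem condExpOp_ae_eq [IsFiniteMeasure τ] (hX : Measurable X) (hY : Measurable Y)
    (f : Lp ℝ 2 (τ.map X)) :
    (fun ω => condExpOp τ X hX Y hY f (Y ω)) =ᵐ[τ]
      τ[fun ω => f (X ω) | MeasurableSpace.comap Y inferInstance] := by
  refine ae_eq_condExp_of_forall_setIntegral_eq hY.comap_le (integrable_lp_comp hX f)
    (fun s _ _ => (integrable_lp_comp hY _).integrableOn) ?_ ?_
  · rintro s ⟨t, ht, rfl⟩ -
    exact setIntegral_condExpOp hX hY f ht
  · exact ((Lp.stronglyMeasurable _).comp_measurable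
      (comap_measurable Y)).aestronglyMeasurable

theorem norm_sq_condExpOp [IsFiniteMeasure τ] (hX : Measurable X) (hY : Measurable Y)
    (f : Lp ℝ 2 (τ.map X)) :
    ‖condExpOp τ X hX Y hY f‖ ^ 2 =
      ∫ ω, (τ[fun ω => f (X ω) | MeasurableSpace.comap Y inferInstance]) ω ^ 2 ∂τ := by
  rw [← norm_l2Embed hY, ← real_inner_self_eq_norm_sq, L2.inner_def]
  refine integral_congr_ae ?_
  filter_upwards [l2Embed_ae_eq hY (condExpOp τ X hX Y hY f), condExpOp_ae_eq hX hY f] with ω h1 h2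
  rw [h1, ← h2]
  simp [sq]

end CondExpOp

noncomputable section

/-! ### Values of the target policy and the Bellman equation -/

theorem integrable_of_forall_abs_le {α : Type*} [MeasurableSpace α] {ν : Measure α}
    [IsFiniteMeasure ν] {f : α → ℝ} {c : ℝ} (hf : Measurable f) (h : ∀ x, |f x| ≤ c) :
    Integrable f ν :=
  Integrable.of_bound hf.aestronglyMeasurable c (Filter.Eventually.of_forall h)

theorem abs_integral_le_of_ae_abs_le {α : Type*} [MeasurableSpace α] {ν : Measure α}
    [IsProbabilityMeasure ν] {f : α → ℝ} {c : ℝ} (h : ∀ᵐ x ∂ν, |f x| ≤ c) :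
    |∫ x, f x ∂ν| ≤ c := by
  simpa using norm_integral_le_of_norm_le_const (μ := ν) (f := f) (C := c) h

theorem integral_comp_measure {α β : Type*} [MeasurableSpace α] [MeasurableSpace β]
    {ν : Measure α} {κ : Kernel α β} {f : β → ℝ} (hf : Integrable f (κ ∘ₘ ν)) :
    ∫ y, f y ∂(κ ∘ₘ ν) = ∫ x, ∫ y, f y ∂(κ x) ∂ν := by
  rw [Measure.comp_eq_comp_const_apply] at hf ⊢
  rw [Kernel.integral_comp hf, Kernel.const_apply]

namespace ConfoundedPOMDP

variable {𝒮 𝒪 𝒲 𝒜 : Type*} [MeasurableSpace 𝒮] [MeasurableSpace 𝒪]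
  [MeasurableSpace 𝒲] [MeasurableSpace 𝒜]
  (M : ConfoundedPOMDP 𝒮 𝒪 𝒲 𝒜) (π : Kernel 𝒪 𝒜)

/-- Mean reward given `(s, o, a)`. -/
def meanReward (x : 𝒮 × 𝒪 × 𝒜) : ℝ := ∫ r, r ∂(M.reward x)

/-- Law of the next `(s, o, a)` when the next action follows the target policy. -/
def next : Kernel (𝒮 × 𝒪 × 𝒜) (𝒮 × 𝒪 × 𝒜) := act π ∘ₖ M.trans

instance [IsMarkovKernel π] : IsMarkovKernel (M.next π) := by
  unfold next; infer_instance

/-- Law of `(S_k, O_k, A_k)` when all actions after the first follow the target policy. -/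
def occupation : ℕ → Kernel (𝒮 × 𝒪 × 𝒜) (𝒮 × 𝒪 × 𝒜)
  | 0 => Kernel.id
  | k + 1 => M.next π ∘ₖ occupation k

instance [IsMarkovKernel π] (k : ℕ) : IsMarkovKernel (M.occupation π k) := by
  induction k with
  | zero => unfold occupation; infer_instance
  | succ k ih => unfold occupation; infer_instance

/-- The recursion peels off the last transition; the Bellman equation needs the first one peeled
off. -/
theorem occupation_succ' (k : ℕ) :
    M.occupation π (k + 1) = M.occupation π k ∘ₖ M.next π := by
  induction k with
  | zero => simp [occupation]
  | succ k ih =>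
    rw [occupation, ih, ← Kernel.comp_assoc, ← occupation, ih]

/-- Mean of `R_k` when all actions after the first follow the target policy. -/
def meanRewardAt (k : ℕ) (x : 𝒮 × 𝒪 × 𝒜) : ℝ := ∫ y, M.meanReward y ∂(M.occupation π k x)

theorem measurable_meanReward : Measurable M.meanReward :=
  (StronglyMeasurable.integral_kernel (κ := M.reward)
    (stronglyMeasurable_id (α := ℝ))).measurable

theorem measurable_meanRewardAt (k : ℕ) : Measurable (M.meanRewardAt π k) :=
  (StronglyMeasurable.integral_kernel (κ := M.occupation π k)
    M.measurable_meanReward.stronglyMeasurable).measurable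

variable [IsMarkovKernel π]

/-- The return is a sum of functions of single coordinates, so only the one-time marginals of the
trajectory law enter its mean. The rewards can be dropped between steps: drawing a reward and
forgetting it is the identity (`hfst`). -/
theorem map_trajLaw_eval (k : ℕ) :
    (M.trajLaw π).map (fun τ => τ k) = M.earn ∘ₖ M.occupation π k := by
  have hstep : (M.step π) = (M.earn ∘ₖ act π ∘ₖ M.trans) ∘ₖ
      Kernel.deterministic Prod.fst measurable_fst := by
    rw [Kernel.comp_deterministic_eq_comap]; rfl
  have hfst : Kernel.deterministic Prod.fst measurable_fst ∘ₖ M.earn = Kernel.id := by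
    rw [Kernel.deterministic_comp_eq_map, ← Kernel.fst_eq, earn, Kernel.fst_prod]
  induction k with
  | zero =>
    rw [trajLaw, Kernel.map_comp]
    have h : (fun τ : ℕ → (𝒮 × 𝒪 × 𝒜) × ℝ => τ 0) =
        (fun h : (Π _ : Finset.Iic 0, (𝒮 × 𝒪 × 𝒜) × ℝ) => h ⟨0, Finset.mem_Iic.2 le_rfl⟩) ∘
          Preorder.frestrictLe (π := fun _ => (𝒮 × 𝒪 × 𝒜) × ℝ) 0 := rfl
    rw [h, Kernel.map_comp_right _ (Preorder.measurable_frestrictLe 0) (by fun_prop),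
      Kernel.traj_map_frestrictLe, Kernel.partialTraj_self, ← Kernel.deterministic_comp_eq_map (by fun_prop), Kernel.comp_id,
      Kernel.deterministic_comp_eq_map, ← Kernel.map_comp_right _ (by fun_prop) (by fun_prop)]
    have h2 : (fun h : (Π _ : Finset.Iic 0, (𝒮 × 𝒪 × 𝒜) × ℝ) =>
        h ⟨0, Finset.mem_Iic.2 le_rfl⟩) ∘ (fun x _ => x) = id := rfl
    rw [h2, Kernel.map_id, occupation, Kernel.comp_id]
  | succ k ih =>
    have h1 : (M.trajLaw π).map (fun τ => τ (k + 1)) =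
        M.step π ∘ₖ (M.trajLaw π).map (fun τ => τ k) := by
      rw [trajLaw, Kernel.map_comp, Kernel.map_comp, ← Kernel.comp_assoc]
      congr 1
      rw [← Kernel.traj_comp_partialTraj (Nat.zero_le k), Kernel.map_comp,
        Kernel.map_traj_succ_self, Kernel.traj_comp_partialTraj (Nat.zero_le k),
        ← Kernel.traj_map_frestrictLe, ← Kernel.comp_deterministic_eq_comap, Kernel.comp_assoc,
        Kernel.deterministic_comp_eq_map, ← Kernel.map_comp_right _ (by fun_prop) (by fun_prop)]
      rfl
    rw [h1, ih, hstep, Kernel.comp_assoc, ← Kernel.comp_assoc _ M.earn, hfst, Kernel.id_comp,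
      occupation, next]
    simp only [Kernel.comp_assoc]

theorem exists_reward_bound : ∃ c : ℝ, 0 ≤ c ∧ ∀ x, ∀ᵐ r ∂(M.reward x), |r| ≤ c := by
  obtain ⟨c, hc⟩ := M.reward_bounded
  exact ⟨max c 0, le_max_right _ _, fun x => (hc x).mono fun r hr => hr.trans (le_max_left _ _)⟩

theorem exists_abs_meanReward_le :
    ∃ c : ℝ, 0 ≤ c ∧ (∀ x, |M.meanReward x| ≤ c) ∧ ∀ k x, |M.meanRewardAt π k x| ≤ c := by
  obtain ⟨c, hc0, hc⟩ := M.exists_reward_bound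
  have h : ∀ x, |M.meanReward x| ≤ c := fun x => abs_integral_le_of_ae_abs_le (hc x)
  exact ⟨c, hc0, h, fun k x => abs_integral_le_of_ae_abs_le (Filter.Eventually.of_forall h)⟩

instance : IsMarkovKernel (M.trajLaw π) := by
  unfold trajLaw
  have : IsMarkovKernel (M.earn.map
      (fun x (_ : Finset.Iic 0) => x)) := Kernel.IsMarkovKernel.map _ (by fun_prop)
  infer_instance

theorem summable_discount {c : ℝ} {a : ℕ → ℝ} (h : ∀ k, |a k| ≤ c) :
    Summable fun k => M.γ ^ k * a k := by
  refine Summable.of_norm_bounded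
    ((summable_geometric_of_lt_one M.γ_nonneg M.γ_lt_one).mul_right c) fun k => ?_
  rw [Real.norm_eq_abs, abs_mul, abs_of_nonneg (pow_nonneg M.γ_nonneg k)]
  exact mul_le_mul_of_nonneg_left (h k) (pow_nonneg M.γ_nonneg k)

theorem integral_tsum_discount {α : Type*} [MeasurableSpace α] {ν : Measure α}
    [IsProbabilityMeasure ν] {c : ℝ} {F : ℕ → α → ℝ} (hF : ∀ k, Measurable (F k))
    (h : ∀ k, ∀ᵐ x ∂ν, |F k x| ≤ c) :
    ∫ x, (∑' k, M.γ ^ k * F k x) ∂ν = ∑' k, M.γ ^ k * ∫ x, F k x ∂ν := by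
  have hint : ∀ k, Integrable (F k) ν := fun k =>
    Integrable.of_bound (hF k).aestronglyMeasurable c (h k)
  rw [← integral_tsum_of_summable_integral_norm (fun k => (hint k).const_mul _)]
  · simp_rw [integral_const_mul]
  · simp_rw [norm_mul, integral_const_mul, norm_pow, Real.norm_of_nonneg M.γ_nonneg]
    refine M.summable_discount (c := c) fun k => ?_
    refine abs_integral_le_of_ae_abs_le ((h k).mono fun x hx => ?_)
    rwa [Real.norm_eq_abs, abs_abs]

/-- A general initial law treats both values at once: a Dirac mass gives `qValue`, and `act π x`
gives `vValue`. Sum and integral are exchanged by the geometric bound on discounted rewards. -/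
theorem integral_ret_comp (ν : Measure (𝒮 × 𝒪 × 𝒜)) [IsProbabilityMeasure ν] :
    ∫ τ, M.ret τ ∂(M.trajLaw π ∘ₘ ν) = ∑' k, M.γ ^ k * ∫ x, M.meanRewardAt π k x ∂ν := by
  obtain ⟨c, -, hc⟩ := M.exists_reward_bound
  have hset : MeasurableSet {y : (𝒮 × 𝒪 × 𝒜) × ℝ | |y.2| ≤ c} :=
    measurableSet_le (by fun_prop) measurable_const
  have hearn : ∀ x, ∀ᵐ y ∂(M.earn x), |y.2| ≤ c := fun x => by
    have h1 : (M.earn x).map Prod.snd = M.reward x := by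
      rw [← Kernel.map_apply _ measurable_snd, ← Kernel.snd_eq, earn, Kernel.snd_prod]
    refine ae_of_ae_map (p := fun r => |r| ≤ c) measurable_snd.aemeasurable ?_
    rw [h1]; exact hc x
  have hmap : ∀ k, (M.trajLaw π ∘ₘ ν).map (fun τ => τ k) =
      M.earn ∘ₘ (M.occupation π k ∘ₘ ν) := fun k => by
    rw [Measure.map_comp _ _ (by fun_prop), map_trajLaw_eval, Measure.comp_assoc]
  have hbd : ∀ k, ∀ᵐ τ ∂(M.trajLaw π ∘ₘ ν), |(τ k).2| ≤ c := fun k => by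
    refine ae_of_ae_map (p := fun y : (𝒮 × 𝒪 × 𝒜) × ℝ => |y.2| ≤ c)
      (f := fun τ : ℕ → (𝒮 × 𝒪 × 𝒜) × ℝ => τ k) (measurable_pi_apply k).aemeasurable ?_
    rw [hmap]
    exact Measure.ae_comp_of_ae_ae hset (Filter.Eventually.of_forall hearn)
  unfold ret
  rw [M.integral_tsum_discount (fun k => by fun_prop) hbd]
  congr 1 with k
  congr 1
  have hearn_int : ∀ x, ∫ y, y.2 ∂(M.earn x) = M.meanReward x := fun x => by
    have h1 : (M.earn x).map Prod.snd = M.reward x := by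
      rw [← Kernel.map_apply _ measurable_snd, ← Kernel.snd_eq, earn, Kernel.snd_prod]
    rw [meanReward, ← h1, integral_map measurable_snd.aemeasurable (by fun_prop)]
  calc ∫ τ, (τ k).2 ∂(M.trajLaw π ∘ₘ ν)
      = ∫ y, y.2 ∂(M.earn ∘ₘ (M.occupation π k ∘ₘ ν)) := by
        rw [← hmap, integral_map (measurable_pi_apply k).aemeasurable (by fun_prop)]
    _ = ∫ x, M.meanReward x ∂(M.occupation π k ∘ₘ ν) := by
        rw [integral_comp_measure (Integrable.of_bound (by fun_prop) c
          (Measure.ae_comp_of_ae_ae hset (Filter.Eventually.of_forall hearn)))]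
        simp_rw [hearn_int]
    _ = ∫ x, M.meanRewardAt π k x ∂ν := by
        obtain ⟨c', -, hc', -⟩ := M.exists_abs_meanReward_le π
        rw [integral_comp_measure (integrable_of_forall_abs_le M.measurable_meanReward hc')]
        rfl

theorem qValue_eq_tsum (x : 𝒮 × 𝒪 × 𝒜) :
    M.qValue π x = ∑' k, M.γ ^ k * M.meanRewardAt π k x := by
  have h := M.integral_ret_comp π (Measure.dirac x)
  rw [Measure.dirac_bind (Kernel.measurable _)] at h
  rw [qValue, h]
  simp_rw [integral_dirac' _ _ (M.measurable_meanRewardAt π _).stronglyMeasurable]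

theorem measurable_qValue : Measurable (M.qValue π) := by
  obtain ⟨c, -, -, hc⟩ := M.exists_abs_meanReward_le π
  refine measurable_of_tendsto_metrizable
    (f := fun n x => ∑ k ∈ Finset.range n, M.γ ^ k * M.meanRewardAt π k x)
    (fun n => Finset.measurable_sum _ fun k _ => (M.measurable_meanRewardAt π k).const_mul _) ?_
  refine tendsto_pi_nhds.2 fun x => ?_
  rw [qValue_eq_tsum]
  exact (M.summable_discount fun k => hc k x).hasSum.tendsto_sum_nat

theorem exists_abs_qValue_le : ∃ c : ℝ, ∀ x, |M.qValue π x| ≤ c := by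
  obtain ⟨c, -, -, hc⟩ := M.exists_abs_meanReward_le π
  have hs := (summable_geometric_of_lt_one M.γ_nonneg M.γ_lt_one).mul_right c
  refine ⟨∑' k, M.γ ^ k * c, fun x => ?_⟩
  rw [qValue_eq_tsum, ← Real.norm_eq_abs]
  refine tsum_of_norm_bounded hs.hasSum fun k => ?_
  rw [Real.norm_eq_abs, abs_mul, abs_of_nonneg (pow_nonneg M.γ_nonneg k)]
  exact mul_le_mul_of_nonneg_left (hc k x) (pow_nonneg M.γ_nonneg k)

theorem integral_qValue (ν : Measure (𝒮 × 𝒪 × 𝒜)) [IsProbabilityMeasure ν] :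
    ∫ x, M.qValue π x ∂ν = ∑' k, M.γ ^ k * ∫ x, M.meanRewardAt π k x ∂ν := by
  obtain ⟨c, -, -, hc⟩ := M.exists_abs_meanReward_le π
  simp_rw [qValue_eq_tsum]
  exact M.integral_tsum_discount (M.measurable_meanRewardAt π)
    fun k => Filter.Eventually.of_forall (hc k)

theorem vValue_eq_integral (x : 𝒮 × 𝒪) :
    M.vValue π x = ∫ y, M.qValue π y ∂(act π x) := by
  rw [vValue, Kernel.comp_apply, integral_ret_comp, integral_qValue]

/-- The Bellman equation. -/
theorem qValue_eq_bellman (x : 𝒮 × 𝒪 × 𝒜) :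
    M.qValue π x = M.meanReward x + M.γ * ∫ y, M.qValue π y ∂(M.next π x) := by
  obtain ⟨c, -, hr, hc⟩ := M.exists_abs_meanReward_le π
  have hsucc : ∀ k, M.meanRewardAt π (k + 1) x = ∫ y, M.meanRewardAt π k y ∂(M.next π x) :=
    fun k => by
      rw [meanRewardAt, occupation_succ', Kernel.integral_comp
        (integrable_of_forall_abs_le M.measurable_meanReward hr)]
      rfl
  have h0 : M.meanRewardAt π 0 x = M.meanReward x := by
    rw [meanRewardAt, occupation, Kernel.id_apply,
      integral_dirac' _ _ M.measurable_meanReward.stronglyMeasurable]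
  rw [integral_qValue, qValue_eq_tsum, (M.summable_discount fun k => hc k x).tsum_eq_zero_add,
    ← tsum_mul_left, h0]
  simp_rw [hsucc]
  simp only [pow_zero, one_mul, pow_succ']
  simp_rw [mul_assoc]

end ConfoundedPOMDP

end

noncomputable section

/-! ### Conditional distributions -/

section CondDistrib

variable {Ω 𝒳 𝒴 𝒵 : Type*} [MeasurableSpace Ω] [MeasurableSpace 𝒳] [MeasurableSpace 𝒴]
  [MeasurableSpace 𝒵] {μ : Measure Ω} [IsProbabilityMeasure μ]
  {X : Ω → 𝒳} {Y : Ω → 𝒴} {Z : Ω → 𝒵} {κ : Kernel 𝒳 𝒴} [IsMarkovKernel κ]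

theorem ProbabilityTheory.HasCondDistrib.condDistrib_ae_eq [StandardBorelSpace 𝒴] [Nonempty 𝒴]
    (h : HasCondDistrib Y X κ μ) : condDistrib Y X μ =ᵐ[μ.map X] κ :=
  (condDistrib_ae_eq_iff_measure_eq_compProd X h.aemeasurable_snd κ).2 h.map_eq

theorem ProbabilityTheory.HasCondDistrib.condExp_ae_eq [StandardBorelSpace 𝒴] [Nonempty Ω]
    (h : HasCondDistrib Y X κ μ) (hX : Measurable X) {f : 𝒳 × 𝒴 → ℝ} (hf : Measurable f)
    (hint : Integrable (fun ω => f (X ω, Y ω)) μ) :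
    μ[fun ω => f (X ω, Y ω) | MeasurableSpace.comap X inferInstance] =ᵐ[μ]
      fun ω => ∫ y, f (X ω, y) ∂(κ (X ω)) := by
  have : Nonempty 𝒴 := Nonempty.map Y ‹_›
  refine (condExp_prod_ae_eq_integral_condDistrib hX h.aemeasurable_snd hf.stronglyMeasurable
    hint).trans ?_
  filter_upwards [ae_of_ae_map hX.aemeasurable h.condDistrib_ae_eq] with ω hω
  rw [hω]

theorem ProbabilityTheory.HasCondDistrib.lintegral_eq (h : HasCondDistrib Y X κ μ)
    {F : 𝒳 × 𝒴 → ℝ≥0∞} (hF : Measurable F) :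
    ∫⁻ ω, F (X ω, Y ω) ∂μ = ∫⁻ x, ∫⁻ y, F (x, y) ∂(κ x) ∂(μ.map X) := by
  rw [← Measure.lintegral_compProd hF, ← h.map_eq,
    lintegral_map' hF.aemeasurable (h.aemeasurable_fst.prodMk h.aemeasurable_snd)]

/-- Conditional independence allows the conditioning variable to be enlarged while the kernel
ignores the new coordinate. Every lagged conditional law of the data comes from this. -/
theorem ProbabilityTheory.HasCondDistrib.prodMk_of_condIndepFun [StandardBorelSpace Ω]
    [Nonempty Ω] [StandardBorelSpace 𝒴] [StandardBorelSpace 𝒵] (h : HasCondDistrib Y X κ μ)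
    (hX : Measurable X) (hY : Measurable Y) (hZ : Measurable Z) (hi : Z ⟂ᵢ[X, hX; μ] Y) :
    HasCondDistrib Y (fun ω => (X ω, Z ω)) (κ.prodMkRight 𝒵) μ := by
  have : Nonempty 𝒴 := Nonempty.map Y ‹_›
  have : Nonempty 𝒵 := Nonempty.map Z ‹_›
  have h1 := (condIndepFun_iff_condDistrib_prod_ae_eq_prodMkRight hY hZ hX).1 hi
  refine ⟨((hX.prodMk hZ).prodMk hY).aemeasurable, ?_⟩
  rw [← condDistrib_ae_eq_iff_measure_eq_compProd (fun ω => (X ω, Z ω)) hY.aemeasurable]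
  refine h1.trans ?_
  have h2 : ∀ᵐ x ∂((μ.map (fun ω => (X ω, Z ω))).map Prod.fst), condDistrib Y X μ x = κ x := by
    rw [Measure.map_map measurable_fst (hX.prodMk hZ)]
    exact h.condDistrib_ae_eq
  filter_upwards [ae_of_ae_map measurable_fst.aemeasurable h2] with x hx
  exact hx

end CondDistrib

/-! ### Fibres of a random variable -/

section Fibre

variable {Ω 𝒳 𝒴 : Type*} [MeasurableSpace Ω] [StandardBorelSpace Ω] [Nonempty Ω]
  [MeasurableSpace 𝒳] [MeasurableSpace 𝒴] {μ : Measure Ω} [IsProbabilityMeasure μ]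
  {X : Ω → 𝒳} {Y : Ω → 𝒴}

theorem condDistrib_id_comp (hY : Measurable Y) : condDistrib id Y μ ∘ₘ μ.map Y = μ := by
  rw [condDistrib_comp_map hY.aemeasurable aemeasurable_id, Measure.map_id]

theorem ae_of_ae_ae_fibre (hY : Measurable Y) {p : Ω → Prop} (hp : MeasurableSet {ω | p ω})
    (h : ∀ᵐ y ∂(μ.map Y), ∀ᵐ ω ∂(condDistrib id Y μ y), p ω) : ∀ᵐ ω ∂μ, p ω := by
  rw [← condDistrib_id_comp (μ := μ) hY]
  exact Measure.ae_comp_of_ae_ae hp h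

theorem integrable_fibre (hY : Measurable Y) {F : Ω → ℝ} (hF : Integrable F μ) :
    (∀ᵐ y ∂(μ.map Y), Integrable F (condDistrib id Y μ y)) ∧
      Integrable (fun y => ∫ ω, F ω ∂(condDistrib id Y μ y)) (μ.map Y) := by
  have h := hF
  rw [← condDistrib_id_comp (μ := μ) hY] at h
  refine ⟨((Measure.integrable_comp_iff h.1).1 h).1, ?_⟩
  rw [Measure.comp_eq_comp_const_apply] at h
  simpa using h.integral_comp

theorem integral_fibre (hY : Measurable Y) {F : Ω → ℝ} (hF : Integrable F μ) :
    ∫ y, ∫ ω, F ω ∂(condDistrib id Y μ y) ∂(μ.map Y) = ∫ ω, F ω ∂μ := by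
  rw [← integral_comp_measure, condDistrib_id_comp hY]
  rwa [condDistrib_id_comp hY]

/-- The joint law of `(Y, ω)` lives on the graph of `Y`, which is measurable because `𝒴` is standard
Borel. -/
theorem ae_fibre_eq [StandardBorelSpace 𝒴] (hY : Measurable Y) :
    ∀ᵐ y ∂(μ.map Y), ∀ᵐ ω ∂(condDistrib id Y μ y), Y ω = y := by
  have hs : MeasurableSet {z : 𝒴 × Ω | Y z.2 = z.1} :=
    measurableSet_eq_fun (hY.comp measurable_snd) measurable_fst
  refine Measure.ae_ae_of_ae_compProd (p := fun z : 𝒴 × Ω => Y z.2 = z.1) ?_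
  rw [compProd_map_condDistrib aemeasurable_id, ae_map_iff (by fun_prop) hs]
  exact Filter.Eventually.of_forall fun ω => rfl

/-- Countability allows the exceptional null sets of fibres, one for each test set, to be merged
into one. -/
theorem exists_countable_isPiSystem (𝒳 : Type*) [m : MeasurableSpace 𝒳]
    [MeasurableSpace.CountablyGenerated 𝒳] :
    ∃ C : Set (Set 𝒳), C.Countable ∧ IsPiSystem C ∧ Set.univ ∈ C ∧
      m = MeasurableSpace.generateFrom C := by
  refine ⟨generateSetAlgebra (MeasurableSpace.countableGeneratingSet 𝒳),
    countable_generateSetAlgebra (MeasurableSpace.countable_countableGeneratingSet),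
    fun s hs t ht _ => isSetAlgebra_generateSetAlgebra.inter_mem hs ht,
    isSetAlgebra_generateSetAlgebra.univ_mem, ?_⟩
  rw [generateFrom_generateSetAlgebra_eq, MeasurableSpace.generateFrom_countableGeneratingSet]

/-- Integrals over a generating `π`-system containing the whole space determine those over all
measurable sets. -/
theorem setIntegral_preimage_eq_zero_of_isPiSystem {Ω : Type*} [MeasurableSpace Ω]
    {τ : Measure Ω} {X : Ω → 𝒳} (hX : Measurable X) {C : Set (Set 𝒳)} (hC : IsPiSystem C)
    (huniv : Set.univ ∈ C)
    (hgen : ‹MeasurableSpace 𝒳› = MeasurableSpace.generateFrom C) {G : Ω → ℝ}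
    (hG : Integrable G τ) (h : ∀ A ∈ C, ∫ ω in X ⁻¹' A, G ω ∂τ = 0) {A : Set 𝒳}
    (hA : MeasurableSet A) : ∫ ω in X ⁻¹' A, G ω ∂τ = 0 := by
  have htot : ∫ ω, G ω ∂τ = 0 := by simpa using h _ huniv
  induction A, hA using MeasurableSpace.induction_on_inter hgen hC with
  | empty => simp
  | basic t ht => exact h t ht
  | compl t ht ih =>
    have h1 := integral_add_compl (hX ht) hG
    rw [ih, htot, zero_add] at h1
    exact h1
  | iUnion f hd hm ih =>
    rw [Set.preimage_iUnion, integral_iUnion (fun i => hX (hm i))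
      (fun i j hij => (hd hij).preimage X) hG.integrableOn]
    simp [ih]

/-- Conditioning on `(Y, X)` is conditioning on `X` in almost every fibre of `Y`. -/
theorem condExp_fibre_ae_eq [StandardBorelSpace 𝒴] [MeasurableSpace.CountablyGenerated 𝒳]
    (hX : Measurable X) (hY : Measurable Y) {F : Ω → ℝ} (hFm : Measurable F)
    (hF : Integrable F μ) {k : 𝒴 × 𝒳 → ℝ} (hk : Measurable k)
    (h : (fun ω => k (Y ω, X ω)) =ᵐ[μ]
      μ[F | MeasurableSpace.comap (fun ω => (Y ω, X ω)) inferInstance]) :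
    ∀ᵐ y ∂(μ.map Y), (fun ω => k (y, X ω)) =ᵐ[condDistrib id Y μ y]
      (condDistrib id Y μ y)[F | MeasurableSpace.comap X inferInstance] := by
  obtain ⟨C, hCc, hCpi, hCu, hCgen⟩ := exists_countable_isPiSystem 𝒳
  have hYX : Measurable (fun ω => (Y ω, X ω)) := hY.prodMk hX
  have hkint : Integrable (fun ω => k (Y ω, X ω)) μ := integrable_condExp.congr h.symm
  have hCm : ∀ A ∈ C, MeasurableSet A := fun A hA => by
    rw [hCgen]; exact MeasurableSpace.measurableSet_generateFrom hA
  set G : Ω → ℝ := fun ω => F ω - k (Y ω, X ω) with hGdef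
  have hGm : Measurable G := hFm.sub (hk.comp hYX)
  have hG : Integrable G μ := hF.sub hkint
  have hG0 : μ[G | MeasurableSpace.comap (fun ω => (Y ω, X ω)) inferInstance] =ᵐ[μ] 0 := by
    have hk' : μ[fun ω => k (Y ω, X ω) |
        MeasurableSpace.comap (fun ω => (Y ω, X ω)) inferInstance] = fun ω => k (Y ω, X ω) :=
      condExp_of_stronglyMeasurable hYX.comap_le
        ((hk.comp (comap_measurable _)).stronglyMeasurable) hkint
    refine (condExp_sub hF hkint _).trans ?_
    rw [hk']
    filter_upwards [h] with ω hω
    simp only [Pi.sub_apply, Pi.zero_apply, ← hω, sub_self]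
  -- For a fixed test set, the tower property gives `E[1_A(X) G | Y] = 0`, which is the vanishing of
  -- the fibre integrals outside a null set depending on `A`.
  have hA : ∀ A ∈ C, ∀ᵐ y ∂(μ.map Y), ∫ ω in X ⁻¹' A, G ω ∂(condDistrib id Y μ y) = 0 := by
    intro A hA
    have hXA : MeasurableSet (X ⁻¹' A) := hX (hCm A hA)
    have hXA' : MeasurableSet[MeasurableSpace.comap (fun ω => (Y ω, X ω)) inferInstance]
        (X ⁻¹' A) := ⟨Prod.snd ⁻¹' A, measurable_snd (hCm A hA), rfl⟩
    have hGA : Measurable ((X ⁻¹' A).indicator G) := hGm.indicator hXA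
    have h1 : μ[(X ⁻¹' A).indicator G | MeasurableSpace.comap Y inferInstance] =ᵐ[μ] 0 := by
      have hle : MeasurableSpace.comap Y inferInstance ≤
          MeasurableSpace.comap (fun ω => (Y ω, X ω)) inferInstance :=
        (measurable_fst.comp (comap_measurable (fun ω => (Y ω, X ω)))).comap_le
      refine (condExp_condExp_of_le hle hYX.comap_le).symm.trans ?_
      have h2 : μ[(X ⁻¹' A).indicator G |
          MeasurableSpace.comap (fun ω => (Y ω, X ω)) inferInstance] =ᵐ[μ] 0 := by
        refine (condExp_indicator hG hXA').trans ?_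
        filter_upwards [hG0] with ω hω
        by_cases hm : ω ∈ X ⁻¹' A
        · rw [Set.indicator_of_mem hm, hω]
        · rw [Set.indicator_of_notMem hm, Pi.zero_apply]
      refine (condExp_congr_ae h2).trans ?_
      rw [condExp_zero]
    have h3 := (condExp_ae_eq_integral_condDistrib_id hY (hG.indicator hXA)).symm.trans h1
    have hset : MeasurableSet {y | ∫ ω, (X ⁻¹' A).indicator G ω ∂(condDistrib id Y μ y) = 0} :=
      measurableSet_eq_fun (StronglyMeasurable.integral_kernel (κ := condDistrib id Y μ)
        hGA.stronglyMeasurable).measurable measurable_const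
    have h4 := (ae_map_iff hY.aemeasurable hset).2 h3
    filter_upwards [h4] with y hy
    rwa [integral_indicator hXA] at hy
  have hall := (ae_ball_iff hCc).2 hA
  filter_upwards [hall, ae_fibre_eq hY, (integrable_fibre hY hG).1, (integrable_fibre hY hF).1,
    (integrable_fibre hY hkint).1] with y h1 h2 h3 h4 h5
  have hkeq : (fun ω => k (Y ω, X ω)) =ᵐ[condDistrib id Y μ y] fun ω => k (y, X ω) := by
    filter_upwards [h2] with ω hω
    rw [hω]
  have h6 := h5.congr hkeq
  refine ae_eq_condExp_of_forall_setIntegral_eq hX.comap_le h4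
    (fun s _ _ => h6.integrableOn) ?_ ?_
  · rintro s ⟨A, hA, rfl⟩ -
    have h7 := setIntegral_preimage_eq_zero_of_isPiSystem hX hCpi hCu hCgen h3 h1 hA
    rw [hGdef, integral_sub h4.integrableOn h5.integrableOn, sub_eq_zero] at h7
    rw [h7]
    exact integral_congr_ae (ae_restrict_of_ae hkeq.symm)
  · exact ((hk.comp (measurable_const.prodMk
      (comap_measurable X))).stronglyMeasurable).aestronglyMeasurable

end Fibre

end

noncomputable section

/-! ### Solving the conditional moment equation -/

section Picard

/-- In one fibre: completeness and the Picard condition bound the pairing with `ψ(S)` by the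
conditional expectation given the reward proxy. -/
theorem sq_integral_mul_le_of_picard {Ω 𝒮 𝒲 𝒵 : Type*} [MeasurableSpace Ω] [MeasurableSpace 𝒮]
    [MeasurableSpace 𝒲] [MeasurableSpace 𝒵] {τ : Measure Ω} [IsProbabilityMeasure τ]
    {S : Ω → 𝒮} {W : Ω → 𝒲} {Z : Ω → 𝒵} (hS : Measurable S) (hW : Measurable W)
    (hZ : Measurable Z) {ψ : 𝒮 → ℝ} (hψ : Measurable ψ) {c : ℝ} (hψc : ∀ s, |ψ s| ≤ c)
    (hcompact : IsCompactOperator (condExpOp τ W hW Z hZ))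
    (hcomplete : ∀ g : 𝒵 → ℝ, Measurable g → MemLp (fun ω => g (Z ω)) 2 τ →
      τ[fun ω => g (Z ω) | MeasurableSpace.comap W inferInstance] =ᵐ[τ] 0 →
      (fun ω => g (Z ω)) =ᵐ[τ] 0) {B : ℝ}
    (hpicard : ∀ (ι : Type) (σ : ι → ℝ) (u : ι → Lp ℝ 2 (τ.map W)) (v : ι → Lp ℝ 2 (τ.map Z)),
      IsSingularSystem (condExpOp τ W hW Z hZ) σ u v →
        Summable (fun i => ((∫ ω, (τ[fun ω' => ψ (S ω') |
          MeasurableSpace.comap Z inferInstance]) ω * v i (Z ω) ∂τ) / σ i) ^ 2) ∧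
        ∑' i, ((∫ ω, (τ[fun ω' => ψ (S ω') |
          MeasurableSpace.comap Z inferInstance]) ω * v i (Z ω) ∂τ) / σ i) ^ 2 ≤ B) :
    0 ≤ B ∧ ∀ g : 𝒵 → ℝ, Measurable g → MemLp (fun ω => g (Z ω)) 2 τ →
      (∫ ω, ψ (S ω) * g (Z ω) ∂τ) ^ 2 ≤
        B * ∫ ω, (τ[fun ω => g (Z ω) | MeasurableSpace.comap W inferInstance]) ω ^ 2 ∂τ := by
  have hψL : MemLp ψ 2 (τ.map S) := by
    have : IsProbabilityMeasure (τ.map S) := Measure.isProbabilityMeasure_map hS.aemeasurable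
    exact MemLp.of_bound hψ.aestronglyMeasurable c (Filter.Eventually.of_forall hψc)
  have hψS : (fun ω => hψL.toLp ψ (S ω)) =ᵐ[τ] fun ω => ψ (S ω) :=
    ae_of_ae_map hS.aemeasurable hψL.coeFn_toLp
  -- `φ` represents `E[ψ(S) | Z]`, so the integrals in the Picard series are its coefficients `⟪φ, v
  -- i⟫`.
  set φ : Lp ℝ 2 (τ.map Z) := condExpOp τ S hS Z hZ (hψL.toLp ψ) with hφ
  have hcoeff : ∀ v : Lp ℝ 2 (τ.map Z), ∫ ω, (τ[fun ω' => ψ (S ω') |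
      MeasurableSpace.comap Z inferInstance]) ω * v (Z ω) ∂τ = inner ℝ φ v := fun v => by
    rw [← inner_l2Embed hZ, L2.inner_def]
    refine integral_congr_ae ?_
    filter_upwards [condExpOp_ae_eq hS hZ (hψL.toLp ψ), condExp_congr_ae
      (m := MeasurableSpace.comap Z inferInstance) hψS, l2Embed_ae_eq hZ φ, l2Embed_ae_eq hZ v]
      with ω h1 h2 h3 h4
    rw [h3, h4, hφ, h1, h2]
    simp [mul_comm]
  simp_rw [hcoeff] at hpicard
  obtain ⟨ι, σ, u, v, hsys⟩ := hcompact.exists_isSingularSystem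
  obtain ⟨hsum, hle⟩ := hpicard ι σ u v hsys
  refine ⟨(tsum_nonneg fun i => sq_nonneg _).trans hle, fun g hg hgL => ?_⟩
  have hgL' : MemLp g 2 (τ.map Z) := (memLp_map_measure_iff hg.aestronglyMeasurable
    hZ.aemeasurable).2 hgL
  have hgZ : (fun ω => hgL'.toLp g (Z ω)) =ᵐ[τ] fun ω => g (Z ω) :=
    ae_of_ae_map hZ.aemeasurable hgL'.coeFn_toLp
  have hker : ∀ f, ContinuousLinearMap.adjoint (condExpOp τ W hW Z hZ) f = 0 → f = 0 := by
    intro f hf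
    rw [adjoint_condExpOp] at hf
    have h1 := condExpOp_ae_eq hZ hW f
    have h2 : (fun ω => condExpOp τ Z hZ W hW f (W ω)) =ᵐ[τ] 0 := by
      rw [hf]
      exact ae_of_ae_map hW.aemeasurable (Lp.coeFn_zero ℝ 2 (τ.map W))
    have h3 := hcomplete f (Lp.stronglyMeasurable f).measurable
      ((Lp.memLp f).comp_measurePreserving (hZ.measurePreserving τ)) (h1.symm.trans h2)
    rw [← norm_eq_zero, ← norm_l2Embed hZ, norm_eq_zero]
    refine Lp.ext ?_
    exact (l2Embed_ae_eq hZ f).trans (h3.trans (Lp.coeFn_zero ℝ 2 τ).symm)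
  have h := hsys.sq_inner_le hker hsum hle (hgL'.toLp g)
  rw [adjoint_condExpOp, norm_sq_condExpOp, real_inner_comm, hφ, inner_condExpOp] at h
  have h1 : ∫ ω, hgL'.toLp g (Z ω) * hψL.toLp ψ (S ω) ∂τ = ∫ ω, ψ (S ω) * g (Z ω) ∂τ := by
    refine integral_congr_ae ?_
    filter_upwards [hgZ, hψS] with ω h1 h2
    rw [h1, h2, mul_comm]
  have h2 : ∫ ω, (τ[fun ω => hgL'.toLp g (Z ω) |
      MeasurableSpace.comap W inferInstance]) ω ^ 2 ∂τ =
      ∫ ω, (τ[fun ω => g (Z ω) | MeasurableSpace.comap W inferInstance]) ω ^ 2 ∂τ := by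
    refine integral_congr_ae ?_
    filter_upwards [condExp_congr_ae (m := MeasurableSpace.comap W inferInstance) hgZ] with ω h1
    rw [h1]
  rwa [h1, h2] at h

/-- Pointwise `|I| ≤ √B √J`; Cauchy–Schwarz for `√B` and `√J` concludes. -/
theorem sq_integral_le_mul_of_sq_le {α : Type*} [MeasurableSpace α] {ν : Measure α}
    {I B J : α → ℝ} (hB : Integrable B ν) (hJ : Integrable J ν)
    (hB0 : 0 ≤ᵐ[ν] B) (hJ0 : 0 ≤ᵐ[ν] J) (h : ∀ᵐ x ∂ν, I x ^ 2 ≤ B x * J x) :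
    |∫ x, I x ∂ν| ≤ √(∫ x, B x ∂ν) * √(∫ x, J x ∂ν) := by
  have hmem : ∀ {F : α → ℝ}, Integrable F ν → 0 ≤ᵐ[ν] F → MemLp (fun x => √(F x)) 2 ν := by
    intro F hF hF0
    rw [memLp_two_iff_integrable_sq (Real.continuous_sqrt.comp_aestronglyMeasurable hF.1)]
    refine hF.congr ?_
    filter_upwards [hF0] with x hx
    exact (Real.sq_sqrt hx).symm
  have hsq : ∀ {F : α → ℝ}, 0 ≤ᵐ[ν] F → (∫ x, √(F x) ^ (2 : ℝ) ∂ν) ^ (1 / 2 : ℝ) =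
      √(∫ x, F x ∂ν) := by
    intro F hF0
    rw [Real.sqrt_eq_rpow]
    congr 1
    refine integral_congr_ae ?_
    filter_upwards [hF0] with x hx
    rw [Real.rpow_two, Real.sq_sqrt hx]
  have hh := integral_mul_le_Lp_mul_Lq_of_nonneg (μ := ν) Real.HolderConjugate.two_two
    (f := fun x => √(B x)) (g := fun x => √(J x))
    (Filter.Eventually.of_forall fun x => Real.sqrt_nonneg _)
    (Filter.Eventually.of_forall fun x => Real.sqrt_nonneg _)
    (by simpa using hmem hB hB0) (by simpa using hmem hJ hJ0)
  rw [hsq hB0, hsq hJ0] at hh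
  refine le_trans ?_ hh
  refine (abs_integral_le_integral_abs).trans ?_
  refine integral_mono_of_nonneg (Filter.Eventually.of_forall fun x => abs_nonneg _)
    ((hmem hB hB0).integrable_mul (hmem hJ hJ0)) ?_
  filter_upwards [h, hB0] with x hx hx0
  rw [← Real.sqrt_mul hx0, ← Real.sqrt_sq_eq_abs]
  exact Real.sqrt_le_sqrt hx

variable {Ω 𝒮 𝒴 𝒲 𝒵 : Type*} [MeasurableSpace Ω] [StandardBorelSpace Ω] [Nonempty Ω]
  [MeasurableSpace 𝒮] [MeasurableSpace 𝒴] [StandardBorelSpace 𝒴] [MeasurableSpace 𝒲]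
  [MeasurableSpace.CountablyGenerated 𝒲] [MeasurableSpace 𝒵]
  {μ : Measure Ω} [IsProbabilityMeasure μ]
  {S : Ω → 𝒮} {Y : Ω → 𝒴} {W : Ω → 𝒲} {Z : Ω → 𝒵}

/-- The fibrewise bounds integrate to a bound for the global conditional expectation operator. -/
theorem abs_integral_mul_le_norm_condExpOp (hS : Measurable S) (hY : Measurable Y)
    (hW : Measurable W) (hZ : Measurable Z) {ψ : 𝒮 × 𝒴 → ℝ} (hψ : Measurable ψ) {c : ℝ}
    (hψc : ∀ x, |ψ x| ≤ c) {B : 𝒴 → ℝ} (hB : Integrable B (μ.map Y))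
    (h : ∀ᵐ y ∂(μ.map Y), 0 ≤ B y ∧ ∀ g : 𝒵 → ℝ, Measurable g →
      MemLp (fun ω => g (Z ω)) 2 (condDistrib id Y μ y) →
      (∫ ω, ψ (S ω, y) * g (Z ω) ∂(condDistrib id Y μ y)) ^ 2 ≤
        B y * ∫ ω, ((condDistrib id Y μ y)[fun ω => g (Z ω) |
          MeasurableSpace.comap W inferInstance]) ω ^ 2 ∂(condDistrib id Y μ y))
    (g : Lp ℝ 2 (μ.map (fun ω => (Z ω, Y ω)))) :
    |∫ ω, ψ (S ω, Y ω) * g (Z ω, Y ω) ∂μ| ≤ √(∫ y, B y ∂(μ.map Y)) *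
      ‖condExpOp μ (fun ω => (Z ω, Y ω)) (hZ.prodMk hY) (fun ω => (Y ω, W ω))
        (hY.prodMk hW) g‖ := by
  set k := condExpOp μ (fun ω => (Z ω, Y ω)) (hZ.prodMk hY) (fun ω => (Y ω, W ω))
        (hY.prodMk hW) g with hkdef
  have hgm : Measurable g := (Lp.stronglyMeasurable g).measurable
  have hkm : Measurable k := (Lp.stronglyMeasurable k).measurable
  have hgL : MemLp (fun ω => g (Z ω, Y ω)) 2 μ :=
    (Lp.memLp g).comp_measurePreserving ((hZ.prodMk hY).measurePreserving μ)
  have hkL : MemLp (fun ω => k (Y ω, W ω)) 2 μ :=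
    (Lp.memLp k).comp_measurePreserving ((hY.prodMk hW).measurePreserving μ)
  have hgmΩ : Measurable (fun ω => g (Z ω, Y ω)) := hgm.comp (hZ.prodMk hY)
  have hk2 := hkL.integrable_sq
  have hg2 := hgL.integrable_sq
  -- On almost every fibre, the section of the global conditional expectation `k` is the fibre's own
  -- conditional expectation given `W`; thus the fibre norms of `K* g` integrate to `‖k‖²`.
  have hfib := condExp_fibre_ae_eq hW hY hgmΩ (hgL.integrable one_le_two) hkm
    (condExpOp_ae_eq (hZ.prodMk hY) (hY.prodMk hW) g)
  have hI : Integrable (fun ω => ψ (S ω, Y ω) * g (Z ω, Y ω)) μ :=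
    (hgL.integrable one_le_two).bdd_mul (hψ.comp (hS.prodMk hY)).aestronglyMeasurable
      (Filter.Eventually.of_forall fun ω => hψc _)
  have hnorm : ‖k‖ = √(∫ y, ∫ ω, k (Y ω, W ω) ^ 2 ∂(condDistrib id Y μ y) ∂(μ.map Y)) := by
    rw [integral_fibre hY hk2, ← Real.sqrt_sq (norm_nonneg k), hkdef, norm_sq_condExpOp]
    congr 1
    refine integral_congr_ae ?_
    filter_upwards [condExpOp_ae_eq (hZ.prodMk hY) (hY.prodMk hW) g] with ω hω
    rw [← hω]
  rw [hnorm, ← integral_fibre hY hI]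
  refine sq_integral_le_mul_of_sq_le hB (integrable_fibre hY hk2).2 (h.mono fun y hy => hy.1)
    (Filter.Eventually.of_forall fun y => integral_nonneg fun ω => sq_nonneg _) ?_
  filter_upwards [h, hfib, ae_fibre_eq hY, (integrable_fibre hY hg2).1] with y h1 h2 h3 h4
  have hgy : (fun ω => g (Z ω, Y ω)) =ᵐ[condDistrib id Y μ y] fun ω => g (Z ω, y) := by
    filter_upwards [h3] with ω hω
    rw [hω]
  have h5 := h1.2 (fun z => g (z, y)) (hgm.comp measurable_prodMk_right)
    ((memLp_congr_ae hgy).1 ((memLp_two_iff_integrable_sq hgmΩ.aestronglyMeasurable).2 h4))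
  have h6 : ∫ ω, ψ (S ω, Y ω) * g (Z ω, Y ω) ∂(condDistrib id Y μ y) =
      ∫ ω, ψ (S ω, y) * g (Z ω, y) ∂(condDistrib id Y μ y) := by
    refine integral_congr_ae ?_
    filter_upwards [h3] with ω hω
    rw [hω]
  have h7 : ∫ ω, k (Y ω, W ω) ^ 2 ∂(condDistrib id Y μ y) =
      ∫ ω, ((condDistrib id Y μ y)[fun ω => g (Z ω, y) |
          MeasurableSpace.comap W inferInstance]) ω ^ 2 ∂(condDistrib id Y μ y) := by
    refine integral_congr_ae ?_
    filter_upwards [h2, h3, condExp_congr_ae (m := MeasurableSpace.comap W inferInstance) hgy]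
      with ω h8 h9 h10
    rw [h9, h8, h10]
  rw [h6, h7]
  exact h5

/-- Fibrewise Picard bounds give a jointly measurable square-integrable solution of the
conditional moment equation. -/
theorem exists_condExp_sub_eq_zero (hS : Measurable S) (hY : Measurable Y)
    (hW : Measurable W) (hZ : Measurable Z) {ψ : 𝒮 × 𝒴 → ℝ} (hψ : Measurable ψ) {c : ℝ}
    (hψc : ∀ x, |ψ x| ≤ c) {B : 𝒴 → ℝ} (hB : Integrable B (μ.map Y))
    (h : ∀ᵐ y ∂(μ.map Y), 0 ≤ B y ∧ ∀ g : 𝒵 → ℝ, Measurable g →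
      MemLp (fun ω => g (Z ω)) 2 (condDistrib id Y μ y) →
      (∫ ω, ψ (S ω, y) * g (Z ω) ∂(condDistrib id Y μ y)) ^ 2 ≤
        B y * ∫ ω, ((condDistrib id Y μ y)[fun ω => g (Z ω) |
          MeasurableSpace.comap W inferInstance]) ω ^ 2 ∂(condDistrib id Y μ y)) :
    ∃ f : 𝒴 × 𝒲 → ℝ, Measurable f ∧ MemLp (fun ω => f (Y ω, W ω)) 2 μ ∧
      μ[fun ω => f (Y ω, W ω) - ψ (S ω, Y ω) |
        MeasurableSpace.comap (fun ω => (Z ω, Y ω)) inferInstance] =ᵐ[μ] 0 := by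
  have hZY : Measurable (fun ω => (Z ω, Y ω)) := hZ.prodMk hY
  have hYW : Measurable (fun ω => (Y ω, W ω)) := hY.prodMk hW
  have hψm : Measurable (fun ω => ψ (S ω, Y ω)) := hψ.comp (hS.prodMk hY)
  have hI : ∀ g : Lp ℝ 2 (μ.map (fun ω => (Z ω, Y ω))),
      Integrable (fun ω => ψ (S ω, Y ω) * g (Z ω, Y ω)) μ := fun g =>
    (integrable_lp_comp hZY g).bdd_mul hψm.aestronglyMeasurable
      (Filter.Eventually.of_forall fun ω => hψc _)
  -- Representing this functional through the operator `g ↦ E[g(Z,Y) | Y,W]` gives `E[f(Y,W) g(Z,Y)]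
  -- = E[ψ(S,Y) g(Z,Y)]` for all `g`, a weak form of the equation. Indicators `g` then recover the
  -- conditional expectation.
  let ℓ : Lp ℝ 2 (μ.map (fun ω => (Z ω, Y ω))) →ₗ[ℝ] ℝ :=
    { toFun := fun g => ∫ ω, ψ (S ω, Y ω) * g (Z ω, Y ω) ∂μ
      map_add' := fun f g => by
        rw [← integral_add (hI f) (hI g)]
        refine integral_congr_ae ?_
        filter_upwards [ae_of_ae_map hZY.aemeasurable (Lp.coeFn_add f g)] with ω hω
        rw [hω, Pi.add_apply, mul_add]
      map_smul' := fun a g => by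
        rw [RingHom.id_apply, smul_eq_mul, ← integral_const_mul]
        refine integral_congr_ae ?_
        filter_upwards [ae_of_ae_map hZY.aemeasurable (Lp.coeFn_smul a g)] with ω hω
        rw [hω, Pi.smul_apply, smul_eq_mul]
        ring }
  obtain ⟨f, hf⟩ := ContinuousLinearMap.exists_inner_apply_eq (ℓ := ℓ)
    (abs_integral_mul_le_norm_condExpOp hS hY hW hZ hψ hψc hB h)
  have hfL : MemLp (fun ω => f (Y ω, W ω)) 2 μ :=
    (Lp.memLp f).comp_measurePreserving (hYW.measurePreserving μ)
  have hψint : Integrable (fun ω => ψ (S ω, Y ω)) μ :=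
    integrable_of_forall_abs_le hψm fun ω => hψc _
  refine ⟨f, (Lp.stronglyMeasurable f).measurable, hfL, ?_⟩
  refine (ae_eq_condExp_of_forall_setIntegral_eq hZY.comap_le
    ((hfL.integrable one_le_two).sub hψint) (fun s _ _ => integrableOn_zero) ?_
    aestronglyMeasurable_zero).symm
  rintro s ⟨t, ht, rfl⟩ -
  set g := indicatorConstLp 2 ht (measure_ne_top (μ.map fun ω => (Z ω, Y ω)) t) (1 : ℝ) with hg
  have hind : ∀ᵐ ω ∂μ, g (Z ω, Y ω) = t.indicator (fun _ => (1 : ℝ)) (Z ω, Y ω) :=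
    ae_of_ae_map hZY.aemeasurable indicatorConstLp_coeFn
  have h1 := hf g
  rw [inner_condExpOp] at h1
  have h2 : ∀ F : Ω → ℝ, ∫ ω, F ω * g (Z ω, Y ω) ∂μ =
      ∫ ω in (fun ω => (Z ω, Y ω)) ⁻¹' t, F ω ∂μ := fun F => by
    rw [← integral_indicator (hZY ht)]
    refine integral_congr_ae ?_
    filter_upwards [hind] with ω hω
    rw [hω]
    by_cases hm : (Z ω, Y ω) ∈ t
    · simp [hm]
    · simp [hm]
  change ∫ ω, f (Y ω, W ω) * g (Z ω, Y ω) ∂μ = ∫ ω, ψ (S ω, Y ω) * g (Z ω, Y ω) ∂μ at h1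
  rw [h2, h2] at h1
  rw [integral_sub' (hfL.integrable one_le_two).integrableOn hψint.integrableOn, h1, sub_self]
  simp

end Picard

end

noncomputable section

/-! ### Conditional laws of the data process -/

theorem ConfoundedPOMDP.act_apply {𝒮 𝒪 𝒜 : Type*} [MeasurableSpace 𝒮] [MeasurableSpace 𝒪]
    [MeasurableSpace 𝒜] (π : Kernel 𝒪 𝒜) [IsMarkovKernel π] (x : 𝒮 × 𝒪) :
    act π x = (π x.2).map (fun a => (x.1, x.2, a)) := by
  rw [act, Kernel.map_apply _ (by fun_prop), Kernel.prod_apply, Kernel.id_apply,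
    Kernel.comap_apply, Measure.dirac_prod, Measure.map_map (by fun_prop) (by fun_prop)]
  rfl

namespace DataProcess

variable {Ω 𝒮 𝒪 𝒲 𝒜 : Type*} [MeasurableSpace Ω] [MeasurableSpace 𝒮]
  [MeasurableSpace 𝒪] [MeasurableSpace 𝒲] [MeasurableSpace 𝒜]
  {μ : Measure Ω} [IsProbabilityMeasure μ]
  {M : ConfoundedPOMDP 𝒮 𝒪 𝒲 𝒜} {D : DataProcess Ω 𝒮 𝒪 𝒲 𝒜} {T : ℕ}
  {π : Kernel 𝒪 𝒜}

/-- The projection `(s, o, a) ↦ (s, o)`. -/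
def stateOf (x : 𝒮 × 𝒪 × 𝒜) : 𝒮 × 𝒪 := (x.1, x.2.1)

theorem measurable_stateOf : Measurable (stateOf : 𝒮 × 𝒪 × 𝒜 → 𝒮 × 𝒪) := by
  unfold stateOf; fun_prop

theorem GeneratedBy.proxy_state (hgen : D.GeneratedBy μ M T) {t : ℕ} (ht : t ≤ T + 1) :
    HasCondDistrib (D.W t) (D.SO t) M.proxy μ :=
  HasCondDistrib.comp_right (f := Prod.snd) (hf := measurable_snd) (hgen.proxy t ht)

/-- The proxy of time `t + 1`, possibly `T + 1`, lies beyond the range of `RewardProxy`; its law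
comes from the generating mechanism, keeping only times `t` and `t - 1` of the past. -/
theorem GeneratedBy.proxy_next (hgen : D.GeneratedBy μ M T) {t : ℕ} (ht1 : 1 ≤ t) (ht : t ≤ T) :
    HasCondDistrib (D.W (t + 1)) (fun ω => ((D.SOA t ω, D.OA (t - 1) ω), D.SO (t + 1) ω))
      (Kernel.prodMkLeft ((𝒮 × 𝒪 × 𝒜) × 𝒪 × 𝒜) M.proxy) μ := by
  let f : (Fin (t + 1) → 𝒮 × 𝒪 × 𝒜) × 𝒮 × 𝒪 → ((𝒮 × 𝒪 × 𝒜) × 𝒪 × 𝒜) × 𝒮 × 𝒪 :=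
    fun x => ((x.1 (Fin.last t), (x.1 ⟨t - 1, by omega⟩).2), x.2)
  have hf : Measurable f := by fun_prop
  exact HasCondDistrib.comp_right (f := f) (hf := hf)
    (κ := Kernel.prodMkLeft ((𝒮 × 𝒪 × 𝒜) × 𝒪 × 𝒜) M.proxy) (hgen.proxy (t + 1) (by omega))

theorem GeneratedBy.map_state_succ (hgen : D.GeneratedBy μ M T) {t : ℕ} (ht : t ≤ T) :
    μ.map (D.SO (t + 1)) = M.trans ∘ₘ μ.map (D.SOA t) := by
  rw [← Measure.snd_compProd, ← (hgen.state t ht).map_eq,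
    Measure.snd_map_prodMk₀ (D.measurable_SOA t).aemeasurable]

theorem GeneratedBy.integrable_reward (hgen : D.GeneratedBy μ M T) {t : ℕ} (ht : t ≤ T) :
    Integrable (D.R t) μ := by
  obtain ⟨c, -, hc⟩ := M.exists_reward_bound
  have h1 : ∀ᵐ z ∂(μ.map (D.SOA t) ⊗ₘ M.reward), |z.2| ≤ c :=
    Measure.ae_compProd_of_ae_ae (measurableSet_le (by fun_prop) measurable_const)
      (Filter.Eventually.of_forall hc)
  rw [← (hgen.reward t ht).map_eq] at h1
  exact Integrable.of_bound (D.measurable_R t).aestronglyMeasurable c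
    (ae_of_ae_map ((D.measurable_SOA t).prodMk (D.measurable_R t)).aemeasurable h1)

/-! ### Conditional laws given the action and the lagged action proxy -/

section Independence

variable [StandardBorelSpace Ω] [Nonempty Ω] [StandardBorelSpace 𝒜]

theorem GeneratedBy.proxy_action [StandardBorelSpace 𝒲] (hgen : D.GeneratedBy μ M T)
    (hreward : D.RewardProxy μ T)
    {t : ℕ} (ht : t ≤ T) :
    HasCondDistrib (D.W t) (D.SOA t) (M.proxy.comap stateOf measurable_stateOf) μ := by
  have hi : D.A t ⟂ᵢ[D.SO t, D.measurable_SO t; μ] D.W t := by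
    rcases Nat.eq_zero_or_pos t with rfl | hpos
    · exact hreward.indep_zero.symm
    · exact ((hreward.indep t hpos ht).comp measurable_id measurable_fst).symm
  have h := (hgen.proxy_state (t := t) (by omega)).prodMk_of_condIndepFun (D.measurable_SO t)
    (D.measurable_W t) (D.measurable_A t) hi
  let f : (𝒮 × 𝒪) × 𝒜 → 𝒮 × 𝒪 × 𝒜 := fun x => (x.1.1, x.1.2, x.2)
  have hf : Measurable f := by fun_prop
  exact HasCondDistrib.comp_right (f := f) (hf := hf)
    (κ := M.proxy.comap stateOf measurable_stateOf) h

theorem GeneratedBy.proxy_lag [StandardBorelSpace 𝒪] [StandardBorelSpace 𝒲]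
    (hgen : D.GeneratedBy μ M T) (hreward : D.RewardProxy μ T)
    (haction : D.ActionProxy μ T) {t : ℕ} (ht1 : 1 ≤ t) (ht : t ≤ T) :
    HasCondDistrib (D.W t) (fun ω => (D.SOA t ω, D.OA (t - 1) ω))
      ((M.proxy.comap stateOf measurable_stateOf).prodMkRight (𝒪 × 𝒜)) μ :=
  (hgen.proxy_action hreward ht).prodMk_of_condIndepFun (D.measurable_SOA t) (D.measurable_W t)
    (D.measurable_OA (t - 1)) ((haction t ht1 ht).comp measurable_id measurable_fst)

theorem GeneratedBy.reward_lag [StandardBorelSpace 𝒪] (hgen : D.GeneratedBy μ M T)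
    (haction : D.ActionProxy μ T) {t : ℕ} (ht1 : 1 ≤ t) (ht : t ≤ T) :
    HasCondDistrib (D.R t) (fun ω => (D.SOA t ω, D.OA (t - 1) ω))
      (M.reward.prodMkRight (𝒪 × 𝒜)) μ :=
  (hgen.reward t ht).prodMk_of_condIndepFun (D.measurable_SOA t) (D.measurable_R t)
    (D.measurable_OA (t - 1)) ((haction t ht1 ht).comp measurable_id measurable_snd)

theorem GeneratedBy.state_lag [StandardBorelSpace 𝒪] [StandardBorelSpace 𝒮]
    (hgen : D.GeneratedBy μ M T) (hmarkov : D.Markovian μ T) {t : ℕ} (ht1 : 1 ≤ t) (ht : t ≤ T) :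
    HasCondDistrib (D.SO (t + 1)) (fun ω => (D.SOA t ω, D.OA (t - 1) ω))
      (M.trans.prodMkRight (𝒪 × 𝒜)) μ := by
  let f : (Fin t → 𝒮 × 𝒪 × 𝒜) → 𝒪 × 𝒜 := fun x => (x ⟨t - 1, by omega⟩).2
  have hf : Measurable f := by fun_prop
  exact (hgen.state t ht).prodMk_of_condIndepFun (D.measurable_SOA t) (D.measurable_SO (t + 1))
    (D.measurable_OA (t - 1)) ((hmarkov t ht).comp measurable_id hf).symm

end Independence

/-! ### Coverage -/

/-- The data at time `t₀` cover the states of all times and the actions of the target policy. -/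
structure Covered (D : DataProcess Ω 𝒮 𝒪 𝒲 𝒜) (μ : Measure Ω) (M : ConfoundedPOMDP 𝒮 𝒪 𝒲 𝒜)
    (π : Kernel 𝒪 𝒜) (T t₀ : ℕ) : Prop where
  le : t₀ ≤ T
  state : ∃ C : ℝ≥0, ∀ t ≤ T + 1, μ.map (D.SO t) ≤ C • μ.map (D.SO t₀)
  policy : ∃ C : ℝ≥0, ∀ᵐ x ∂(μ.map (D.SO t₀)), π x.2 ≤ C • M.behavior x

theorem GeneratedBy.lintegral_SOA (hgen : D.GeneratedBy μ M T) {t : ℕ} (ht : t ≤ T)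
    {F : 𝒮 × 𝒪 × 𝒜 → ℝ≥0∞} (hF : Measurable F) :
    ∫⁻ ω, F (D.SOA t ω) ∂μ =
      ∫⁻ x, ∫⁻ a, F (x.1, x.2, a) ∂(M.behavior x) ∂(μ.map (D.SO t)) :=
  (hgen.action t ht).lintegral_eq (F := fun z => F (z.1.1, z.1.2, z.2)) (by fun_prop)

/-- The behavior policy is the same at all times, so domination of the state laws passes to the laws
of `(S_t, O_t, A_t)`. Stating it for all nonnegative `F` serves both integrability and null sets. -/
theorem Covered.exists_lintegral_SOA_le (hgen : D.GeneratedBy μ M T) {t₀ : ℕ}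
    (hcov : D.Covered μ M π T t₀) : ∃ C : ℝ≥0, ∀ t ≤ T, ∀ F : 𝒮 × 𝒪 × 𝒜 → ℝ≥0∞, Measurable F →
      ∫⁻ ω, F (D.SOA t ω) ∂μ ≤ C * ∫⁻ ω, F (D.SOA t₀ ω) ∂μ := by
  obtain ⟨C, hC⟩ := hcov.state
  refine ⟨C, fun t ht F hF => ?_⟩
  rw [hgen.lintegral_SOA ht hF, hgen.lintegral_SOA hcov.le hF]
  refine (lintegral_mono' (hC t (by omega)) le_rfl).trans_eq ?_
  rw [lintegral_smul_measure]
  rfl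

/-- Two changes of measure: from the states of time `t` to those of `t₀`, then from `π` to the
behavior policy. The constants multiply. -/
theorem Covered.exists_lintegral_policy_le (hgen : D.GeneratedBy μ M T) {t₀ : ℕ}
    (hcov : D.Covered μ M π T t₀) :
    ∃ C : ℝ≥0, ∀ t ≤ T + 1, ∀ F : 𝒮 × 𝒪 × 𝒜 → ℝ≥0∞, Measurable F →
      ∫⁻ x, ∫⁻ a, F (x.1, x.2, a) ∂(π x.2) ∂(μ.map (D.SO t)) ≤
        C * ∫⁻ ω, F (D.SOA t₀ ω) ∂μ := by
  obtain ⟨C, hC⟩ := hcov.state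
  obtain ⟨C', hC'⟩ := hcov.policy
  refine ⟨C * C', fun t ht F hF => ?_⟩
  refine (lintegral_mono' (hC t ht) le_rfl).trans ?_
  rw [lintegral_smul_measure, hgen.lintegral_SOA hcov.le hF, ENNReal.coe_mul, mul_assoc]
  refine mul_le_mul_right (α := ℝ≥0∞) ?_ _
  rw [← lintegral_const_mul' _ _ ENNReal.coe_ne_top]
  refine lintegral_mono_ae ?_
  filter_upwards [hC'] with x hx
  refine (lintegral_mono' hx le_rfl).trans_eq ?_
  rw [lintegral_smul_measure]
  rfl

theorem Covered.ae_SOA (hgen : D.GeneratedBy μ M T) {t₀ : ℕ}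
    (hcov : D.Covered μ M π T t₀) {p : 𝒮 × 𝒪 × 𝒜 → Prop} (hp : MeasurableSet {x | p x})
    (h : ∀ᵐ ω ∂μ, p (D.SOA t₀ ω)) {t : ℕ} (ht : t ≤ T) : ∀ᵐ ω ∂μ, p (D.SOA t ω) := by
  obtain ⟨C, hC⟩ := hcov.exists_lintegral_SOA_le hgen
  have hF : Measurable ({x | p x}ᶜ.indicator (fun _ => (1 : ℝ≥0∞))) :=
    measurable_const.indicator hp.compl
  have h1 := hC t ht _ hF
  have h2 : ∫⁻ ω, {x | p x}ᶜ.indicator (fun _ => (1 : ℝ≥0∞)) (D.SOA t₀ ω) ∂μ = 0 := by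
    refine (lintegral_eq_zero_iff (hF.comp (D.measurable_SOA t₀))).2 ?_
    filter_upwards [h] with ω hω
    simp [hω]
  rw [h2, mul_zero, nonpos_iff_eq_zero] at h1
  filter_upwards [(lintegral_eq_zero_iff (hF.comp (D.measurable_SOA t))).1 h1] with ω hω
  simpa using hω

theorem Covered.ae_act [IsMarkovKernel π] (hgen : D.GeneratedBy μ M T) {t₀ : ℕ}
    (hcov : D.Covered μ M π T t₀) {p : 𝒮 × 𝒪 × 𝒜 → Prop} (hp : MeasurableSet {x | p x})
    (h : ∀ᵐ ω ∂μ, p (D.SOA t₀ ω)) {t : ℕ} (ht : t ≤ T + 1) :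
    ∀ᵐ x ∂(μ.map (D.SO t)), ∀ᵐ z ∂(ConfoundedPOMDP.act π x), p z := by
  obtain ⟨C, hC⟩ := hcov.exists_lintegral_policy_le hgen
  have hF : Measurable ({x | p x}ᶜ.indicator (fun _ => (1 : ℝ≥0∞))) :=
    measurable_const.indicator hp.compl
  have h1 := hC t ht _ hF
  have h2 : ∫⁻ ω, {x | p x}ᶜ.indicator (fun _ => (1 : ℝ≥0∞)) (D.SOA t₀ ω) ∂μ = 0 := by
    refine (lintegral_eq_zero_iff (hF.comp (D.measurable_SOA t₀))).2 ?_
    filter_upwards [h] with ω hω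
    simp [hω]
  have h3 : ∀ x : 𝒮 × 𝒪, ∫⁻ a, {x | p x}ᶜ.indicator (fun _ => (1 : ℝ≥0∞)) (x.1, x.2, a) ∂(π x.2)
      = ConfoundedPOMDP.act π x {x | p x}ᶜ := fun x => by
    rw [← lintegral_indicator_one hp.compl, ConfoundedPOMDP.act_apply,
      lintegral_map (measurable_one.indicator hp.compl) (by fun_prop)]
    rfl
  rw [h2, mul_zero, nonpos_iff_eq_zero] at h1
  simp_rw [h3] at h1
  rw [lintegral_eq_zero_iff (Kernel.measurable_coe _ hp.compl)] at h1
  filter_upwards [h1] with x hx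
  exact hx

/-- The law of the next state is a mixture of transition laws over `(S_t, O_t, A_t)`. Hence a
property certain at `t₀` holds after one transition followed by an action from `π`, which is what
the Bellman operator averages over. -/
theorem Covered.ae_trans_act [IsMarkovKernel π] (hgen : D.GeneratedBy μ M T) {t₀ : ℕ}
    (hcov : D.Covered μ M π T t₀) {p : 𝒮 × 𝒪 × 𝒜 → Prop} (hp : MeasurableSet {x | p x})
    (h : ∀ᵐ ω ∂μ, p (D.SOA t₀ ω)) {t : ℕ} (ht : t ≤ T) :
    ∀ᵐ ω ∂μ, ∀ᵐ y ∂(M.trans (D.SOA t ω)), ∀ᵐ z ∂(ConfoundedPOMDP.act π y), p z := by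
  have h1 := hcov.ae_act hgen hp h (t := t + 1) (by omega)
  rw [hgen.map_state_succ ht] at h1
  exact ae_of_ae_map (D.measurable_SOA t).aemeasurable (Measure.ae_ae_of_ae_comp h1)

end DataProcess

end

noncomputable section

/-! ### Means of a bridge function over the proxy -/

theorem measurable_policyAverage {𝒪 𝒲 𝒜 : Type*} [MeasurableSpace 𝒪] [MeasurableSpace 𝒲]
    [MeasurableSpace 𝒜] (π : Kernel 𝒪 𝒜) [IsMarkovKernel π] {Q : 𝒪 × 𝒲 × 𝒜 → ℝ}
    (hQ : Measurable Q) : Measurable (policyAverage π Q) :=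
  (StronglyMeasurable.integral_kernel_prod_right'
    (κ := π.comap (Prod.fst : 𝒪 × 𝒲 → 𝒪) measurable_fst)
    (f := fun z : (𝒪 × 𝒲) × 𝒜 => Q (z.1.1, z.1.2, z.2))
    (by fun_prop : Measurable _).stronglyMeasurable).measurable

namespace ConfoundedPOMDP

variable {𝒮 𝒪 𝒲 𝒜 : Type*} [MeasurableSpace 𝒮] [MeasurableSpace 𝒪]
  [MeasurableSpace 𝒲] [MeasurableSpace 𝒜] (M : ConfoundedPOMDP 𝒮 𝒪 𝒲 𝒜)

/-- `(s, o, a) ↦ ∫ Q(o, w, a) p_W(dw | s, o)` -/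
def proxyMean (Q : 𝒪 × 𝒲 × 𝒜 → ℝ) (x : 𝒮 × 𝒪 × 𝒜) : ℝ :=
  ∫ w, Q (x.2.1, w, x.2.2) ∂(M.proxy (x.1, x.2.1))

theorem measurable_proxyMean {Q : 𝒪 × 𝒲 × 𝒜 → ℝ} (hQ : Measurable Q) :
    Measurable (M.proxyMean Q) :=
  (StronglyMeasurable.integral_kernel_prod_right'
    (κ := M.proxy.comap (DataProcess.stateOf (𝒜 := 𝒜)) DataProcess.measurable_stateOf)
    (f := fun z : (𝒮 × 𝒪 × 𝒜) × 𝒲 => Q (z.1.2.1, z.2, z.1.2.2))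
    (by fun_prop : Measurable _).stronglyMeasurable).measurable

/-- Mean of `f(S', O', A')` over the next state and an action from the target policy. -/
def nextMean (π : Kernel 𝒪 𝒜) (f : 𝒮 × 𝒪 × 𝒜 → ℝ) (x : 𝒮 × 𝒪 × 𝒜) : ℝ :=
  ∫ y, ∫ z, f z ∂(act π y) ∂(M.trans x)

theorem measurable_integral_act (π : Kernel 𝒪 𝒜) {f : 𝒮 × 𝒪 × 𝒜 → ℝ} (hf : Measurable f) :
    Measurable fun y => ∫ z, f z ∂(act π y) :=
  (StronglyMeasurable.integral_kernel (κ := act π) hf.stronglyMeasurable).measurable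

theorem measurable_nextMean (π : Kernel 𝒪 𝒜) {f : 𝒮 × 𝒪 × 𝒜 → ℝ} (hf : Measurable f) :
    Measurable (M.nextMean π f) :=
  (StronglyMeasurable.integral_kernel (κ := M.trans)
    (measurable_integral_act π hf).stronglyMeasurable).measurable

theorem qValue_eq_nextMean (π : Kernel 𝒪 𝒜) [IsMarkovKernel π] (x : 𝒮 × 𝒪 × 𝒜) :
    M.qValue π x = M.meanReward x + M.γ * M.nextMean π (M.qValue π) x := by
  obtain ⟨c, hc⟩ := M.exists_abs_qValue_le π
  rw [qValue_eq_bellman, next, Kernel.integral_comp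
    (integrable_of_forall_abs_le (M.measurable_qValue π) hc), nextMean]

theorem integral_act (π : Kernel 𝒪 𝒜) [IsMarkovKernel π] {f : 𝒮 × 𝒪 × 𝒜 → ℝ}
    (hf : Measurable f) (x : 𝒮 × 𝒪) :
    ∫ z, f z ∂(act π x) = ∫ a, f (x.1, x.2, a) ∂(π x.2) := by
  rw [act_apply, integral_map (by fun_prop) hf.aestronglyMeasurable]

/-- Averaging is nonexpansive. The bound on `g` and on the difference also bounds `f` almost
everywhere, which supplies its integrability. -/
theorem abs_nextMean_sub_le (π : Kernel 𝒪 𝒜) [IsMarkovKernel π] {f g : 𝒮 × 𝒪 × 𝒜 → ℝ}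
    (hf : Measurable f) (hg : Measurable g) {c e : ℝ} (hgc : ∀ z, |g z| ≤ c) {x : 𝒮 × 𝒪 × 𝒜}
    (h : ∀ᵐ y ∂(M.trans x), ∀ᵐ z ∂(act π y), |f z - g z| ≤ e) :
    |M.nextMean π f x - M.nextMean π g x| ≤ e := by
  have hfint : ∀ᵐ y ∂(M.trans x), Integrable f (act π y) ∧ |∫ z, f z ∂(act π y)| ≤ c + e := by
    filter_upwards [h] with y hy
    have hb : ∀ᵐ z ∂(act π y), |f z| ≤ c + e := by
      filter_upwards [hy] with z hz
      have := abs_add_le (g z) (f z - g z)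
      rw [add_sub_cancel] at this
      linarith [hgc z]
    exact ⟨Integrable.of_bound hf.aestronglyMeasurable _ hb, abs_integral_le_of_ae_abs_le hb⟩
  have hgint : ∀ y, Integrable g (act π y) := fun y => integrable_of_forall_abs_le hg hgc
  have h1 : Integrable (fun y => ∫ z, f z ∂(act π y)) (M.trans x) :=
    Integrable.of_bound (measurable_integral_act π hf).aestronglyMeasurable _
      (hfint.mono fun y hy => hy.2)
  have h2 : Integrable (fun y => ∫ z, g z ∂(act π y)) (M.trans x) :=
    integrable_of_forall_abs_le (measurable_integral_act π hg) fun y =>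
      abs_integral_le_of_ae_abs_le (Filter.Eventually.of_forall hgc)
  rw [nextMean, nextMean, ← integral_sub h1 h2]
  refine abs_integral_le_of_ae_abs_le ?_
  filter_upwards [h, hfint] with y hy hy'
  rw [← integral_sub hy'.1 (hgint y)]
  exact abs_integral_le_of_ae_abs_le hy

end ConfoundedPOMDP

namespace DataProcess

variable {Ω 𝒮 𝒪 𝒲 𝒜 : Type*} [MeasurableSpace Ω] [MeasurableSpace 𝒮] [MeasurableSpace 𝒪]
  [MeasurableSpace 𝒲] [MeasurableSpace 𝒜] {μ : Measure Ω} [IsProbabilityMeasure μ]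
  {M : ConfoundedPOMDP 𝒮 𝒪 𝒲 𝒜} {D : DataProcess Ω 𝒮 𝒪 𝒲 𝒜} {T t₀ : ℕ}
  {π : Kernel 𝒪 𝒜} {Q : 𝒪 × 𝒲 × 𝒜 → ℝ}

/-- `(O_t, W_t, A_t)` -/
def OWA (D : DataProcess Ω 𝒮 𝒪 𝒲 𝒜) (t : ℕ) (ω : Ω) : 𝒪 × 𝒲 × 𝒜 :=
  (D.O t ω, D.W t ω, D.A t ω)

/-- `(O_t, W_t)` -/
def OW (D : DataProcess Ω 𝒮 𝒪 𝒲 𝒜) (t : ℕ) (ω : Ω) : 𝒪 × 𝒲 := (D.O t ω, D.W t ω)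

theorem measurable_OWA (D : DataProcess Ω 𝒮 𝒪 𝒲 𝒜) (t : ℕ) : Measurable (D.OWA t) := by
  unfold OWA; fun_prop

theorem measurable_OW (D : DataProcess Ω 𝒮 𝒪 𝒲 𝒜) (t : ℕ) : Measurable (D.OW t) := by
  unfold OW; fun_prop

theorem measurable_lintegral_proxy {F : 𝒪 × 𝒲 × 𝒜 → ℝ≥0∞} (hF : Measurable F) :
    Measurable fun x : 𝒮 × 𝒪 × 𝒜 => ∫⁻ w, F (x.2.1, w, x.2.2) ∂(M.proxy (x.1, x.2.1)) :=
  Measurable.lintegral_kernel_prod_right'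
    (κ := M.proxy.comap (stateOf (𝒜 := 𝒜)) measurable_stateOf)
    (f := fun z : (𝒮 × 𝒪 × 𝒜) × 𝒲 => F (z.1.2.1, z.2, z.1.2.2)) (by fun_prop)

variable [StandardBorelSpace Ω] [Nonempty Ω] [StandardBorelSpace 𝒲] [StandardBorelSpace 𝒜]

theorem lintegral_OWA (hgen : D.GeneratedBy μ M T) (hreward : D.RewardProxy μ T) {t : ℕ}
    (ht : t ≤ T) {F : 𝒪 × 𝒲 × 𝒜 → ℝ≥0∞} (hF : Measurable F) :
    ∫⁻ ω, F (D.OWA t ω) ∂μ =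
      ∫⁻ ω, ∫⁻ w, F ((D.SOA t ω).2.1, w, (D.SOA t ω).2.2)
        ∂(M.proxy ((D.SOA t ω).1, (D.SOA t ω).2.1)) ∂μ := by
  have h := (hgen.proxy_action hreward ht).lintegral_eq
    (F := fun z : (𝒮 × 𝒪 × 𝒜) × 𝒲 => F (z.1.2.1, z.2, z.1.2.2)) (by fun_prop)
  exact h.trans (lintegral_map (measurable_lintegral_proxy hF) (D.measurable_SOA t))

theorem Covered.integrable_OWA (hcov : D.Covered μ M π T t₀) (hgen : D.GeneratedBy μ M T)
    (hreward : D.RewardProxy μ T) (hQ : Measurable Q)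
    (hint : Integrable (fun ω => Q (D.OWA t₀ ω)) μ) {t : ℕ} (ht : t ≤ T) :
    Integrable (fun ω => Q (D.OWA t ω)) μ := by
  obtain ⟨C, hC⟩ := hcov.exists_lintegral_SOA_le hgen
  refine ⟨(hQ.comp (D.measurable_OWA t)).aestronglyMeasurable, ?_⟩
  have h0 := hint.2
  rw [hasFiniteIntegral_iff_enorm] at h0 ⊢
  have hF : Measurable fun x => ‖Q x‖ₑ := hQ.enorm
  rw [lintegral_OWA hgen hreward ht hF]
  rw [lintegral_OWA hgen hreward hcov.le hF] at h0
  exact (hC t ht _ (measurable_lintegral_proxy hF)).trans_lt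
    (ENNReal.mul_lt_top ENNReal.coe_lt_top h0)

theorem Covered.memLp_OWA (hcov : D.Covered μ M π T t₀) (hgen : D.GeneratedBy μ M T)
    (hreward : D.RewardProxy μ T) (hQ : Measurable Q)
    (hint : MemLp (fun ω => Q (D.OWA t₀ ω)) 2 μ) {t : ℕ} (ht : t ≤ T) :
    MemLp (fun ω => Q (D.OWA t ω)) 2 μ := by
  refine (memLp_two_iff_integrable_sq (hQ.comp (D.measurable_OWA t)).aestronglyMeasurable).2 ?_
  exact hcov.integrable_OWA hgen hreward (Q := fun x => Q x ^ 2) (hQ.pow_const 2)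
    hint.integrable_sq ht

theorem condExp_OWA (hgen : D.GeneratedBy μ M T) (hreward : D.RewardProxy μ T) {t : ℕ}
    (ht : t ≤ T) (hQ : Measurable Q) (hint : Integrable (fun ω => Q (D.OWA t ω)) μ) :
    μ[fun ω => Q (D.OWA t ω) | MeasurableSpace.comap (D.SOA t) inferInstance] =ᵐ[μ]
      fun ω => M.proxyMean Q (D.SOA t ω) :=
  (hgen.proxy_action hreward ht).condExp_ae_eq (D.measurable_SOA t)
    (f := fun z : (𝒮 × 𝒪 × 𝒜) × 𝒲 => Q (z.1.2.1, z.2, z.1.2.2)) (by fun_prop) hint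

variable [IsMarkovKernel π]

theorem Covered.lintegral_policy_lt_top (hcov : D.Covered μ M π T t₀)
    (hgen : D.GeneratedBy μ M T) (hreward : D.RewardProxy μ T) (hQ : Measurable Q)
    (hint : Integrable (fun ω => Q (D.OWA t₀ ω)) μ) {t : ℕ} (ht : t ≤ T + 1) :
    ∫⁻ x, ∫⁻ w, ∫⁻ a, ‖Q (x.2, w, a)‖ₑ ∂(π x.2) ∂(M.proxy x) ∂(μ.map (D.SO t)) < ∞ := by
  obtain ⟨C, hC⟩ := hcov.exists_lintegral_policy_le hgen
  have h0 := hint.2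
  rw [hasFiniteIntegral_iff_enorm] at h0
  have hF : Measurable fun x => ‖Q x‖ₑ := hQ.enorm
  rw [lintegral_OWA hgen hreward hcov.le hF] at h0
  refine lt_of_eq_of_lt (lintegral_congr fun x => ?_)
    ((hC t ht _ (measurable_lintegral_proxy hF)).trans_lt
      (ENNReal.mul_lt_top ENNReal.coe_lt_top h0))
  exact lintegral_lintegral_swap (by fun_prop)

theorem Covered.integrable_policyAverage (hcov : D.Covered μ M π T t₀)
    (hgen : D.GeneratedBy μ M T) (hreward : D.RewardProxy μ T) (hQ : Measurable Q)
    (hint : Integrable (fun ω => Q (D.OWA t₀ ω)) μ) {t : ℕ} (ht : t ≤ T + 1) :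
    Integrable (fun ω => policyAverage π Q (D.OW t ω)) μ := by
  have hV := measurable_policyAverage π hQ
  refine ⟨(hV.comp (D.measurable_OW t)).aestronglyMeasurable, ?_⟩
  rw [hasFiniteIntegral_iff_enorm]
  have h := (hgen.proxy_state ht).lintegral_eq
    (F := fun z : (𝒮 × 𝒪) × 𝒲 => ‖policyAverage π Q (z.1.2, z.2)‖ₑ) (by fun_prop)
  refine lt_of_le_of_lt ?_ (hcov.lintegral_policy_lt_top hgen hreward hQ hint ht)
  refine h.trans_le ?_
  gcongr with x w
  exact enorm_integral_le_lintegral_enorm _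

/-- Fubini in proxy and action; coverage makes the double integral finite for almost every state. -/
theorem Covered.ae_integral_policyAverage (hcov : D.Covered μ M π T t₀)
    (hgen : D.GeneratedBy μ M T) (hreward : D.RewardProxy μ T) (hQ : Measurable Q)
    (hint : Integrable (fun ω => Q (D.OWA t₀ ω)) μ) {t : ℕ} (ht : t ≤ T + 1) :
    ∀ᵐ x ∂(μ.map (D.SO t)), ∫ w, policyAverage π Q (x.2, w) ∂(M.proxy x) =
      ∫ z, M.proxyMean Q z ∂(ConfoundedPOMDP.act π x) := by
  have hm : Measurable fun x : 𝒮 × 𝒪 =>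
      ∫⁻ w, ∫⁻ a, ‖Q (x.2, w, a)‖ₑ ∂(π x.2) ∂(M.proxy x) := by
    have h1 : Measurable fun z : 𝒪 × 𝒲 => ∫⁻ a, ‖Q (z.1, z.2, a)‖ₑ ∂(π z.1) :=
      Measurable.lintegral_kernel_prod_right'
        (κ := π.comap (Prod.fst : 𝒪 × 𝒲 → 𝒪) measurable_fst)
        (f := fun z : (𝒪 × 𝒲) × 𝒜 => ‖Q (z.1.1, z.1.2, z.2)‖ₑ) (by fun_prop)
    exact Measurable.lintegral_kernel_prod_right' (κ := M.proxy)
      (f := fun z : (𝒮 × 𝒪) × 𝒲 => ∫⁻ a, ‖Q (z.1.2, z.2, a)‖ₑ ∂(π z.1.2))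
      (h1.comp (by fun_prop : Measurable fun z : (𝒮 × 𝒪) × 𝒲 => (z.1.2, z.2)))
  filter_upwards [ae_lt_top hm (hcov.lintegral_policy_lt_top hgen hreward hQ hint ht).ne]
    with x hx
  rw [ConfoundedPOMDP.integral_act π (M.measurable_proxyMean hQ)]
  refine integral_integral_swap (μ := M.proxy x) (ν := π x.2)
    (f := fun w a => Q (x.2, w, a))
    ⟨(hQ.comp (by fun_prop : Measurable fun z : 𝒲 × 𝒜 => (x.2, z.1, z.2))).aestronglyMeasurable, ?_⟩
  rw [hasFiniteIntegral_iff_enorm, lintegral_prod _ (by fun_prop)]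
  exact hx

theorem Covered.condExp_policyAverage (hcov : D.Covered μ M π T t₀)
    (hgen : D.GeneratedBy μ M T) (hreward : D.RewardProxy μ T) (hQ : Measurable Q)
    (hint : Integrable (fun ω => Q (D.OWA t₀ ω)) μ) {t : ℕ} (ht : t ≤ T + 1) :
    μ[fun ω => policyAverage π Q (D.OW t ω) | MeasurableSpace.comap (D.SO t) inferInstance]
      =ᵐ[μ] fun ω => ∫ z, M.proxyMean Q z ∂(ConfoundedPOMDP.act π (D.SO t ω)) := by
  have hV := measurable_policyAverage π hQ
  refine ((hgen.proxy_state ht).condExp_ae_eq (D.measurable_SO t)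
    (f := fun z : (𝒮 × 𝒪) × 𝒲 => policyAverage π Q (z.1.2, z.2)) (by fun_prop)
    (hcov.integrable_policyAverage hgen hreward hQ hint ht)).trans ?_
  exact ae_of_ae_map (D.measurable_SO t).aemeasurable
    (hcov.ae_integral_policyAverage hgen hreward hQ hint ht)

/-- A function whose proxy mean is the value of the target policy at time `t₀` is a bridge. -/
theorem Covered.isBridge (hcov : D.Covered μ M π T t₀)
    (hgen : D.GeneratedBy μ M T) (hreward : D.RewardProxy μ T) (hQ : Measurable Q)
    (hint : Integrable (fun ω => Q (D.OWA t₀ ω)) μ)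
    (h : ∀ᵐ ω ∂μ, M.proxyMean Q (D.SOA t₀ ω) = M.qValue π (D.SOA t₀ ω)) :
    D.IsQBridge μ M π T Q ∧ D.IsVBridge μ M π T (policyAverage π Q) := by
  have hset : MeasurableSet {x | M.proxyMean Q x = M.qValue π x} :=
    measurableSet_eq_fun (M.measurable_proxyMean hQ) (M.measurable_qValue π)
  refine ⟨⟨hQ, fun t ht => ?_⟩, measurable_policyAverage π hQ, fun t ht => ?_⟩
  · have h1 := hcov.integrable_OWA hgen hreward hQ hint ht
    exact ⟨h1, (condExp_OWA hgen hreward ht hQ h1).trans (hcov.ae_SOA hgen hset h ht)⟩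
  · refine ⟨hcov.integrable_policyAverage hgen hreward hQ hint ht,
      (hcov.condExp_policyAverage hgen hreward hQ hint ht).trans ?_⟩
    filter_upwards [ae_of_ae_map (D.measurable_SO t).aemeasurable
      (hcov.ae_act hgen hset h ht)] with ω hω
    rw [M.vValue_eq_integral]
    exact integral_congr_ae hω

end DataProcess

end

noncomputable section

/-! ### The moment equation -/

namespace DataProcess

variable {Ω 𝒮 𝒪 𝒲 𝒜 : Type*} [MeasurableSpace Ω] [MeasurableSpace 𝒮] [MeasurableSpace 𝒪]
  [MeasurableSpace 𝒲] [MeasurableSpace 𝒜] {μ : Measure Ω} [IsProbabilityMeasure μ]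
  {M : ConfoundedPOMDP 𝒮 𝒪 𝒲 𝒜} {D : DataProcess Ω 𝒮 𝒪 𝒲 𝒜} {T t₀ : ℕ}
  {π : Kernel 𝒪 𝒜} [IsMarkovKernel π] {Q : 𝒪 × 𝒲 × 𝒜 → ℝ}

theorem measurable_SOA_lag (D : DataProcess Ω 𝒮 𝒪 𝒲 𝒜) (t : ℕ) :
    Measurable (fun ω => (D.SOA t ω, D.OA (t - 1) ω)) :=
  (D.measurable_SOA t).prodMk (D.measurable_OA (t - 1))

theorem comap_OA_lag_le (D : DataProcess Ω 𝒮 𝒪 𝒲 𝒜) (t : ℕ) :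
    MeasurableSpace.comap (fun ω => (D.OA (t - 1) ω, D.OA t ω)) inferInstance ≤
      MeasurableSpace.comap (fun ω => (D.SOA t ω, D.OA (t - 1) ω)) inferInstance :=
  ((by fun_prop : Measurable fun z : (𝒮 × 𝒪 × 𝒜) × 𝒪 × 𝒜 => (z.2, z.1.2)).comp
    (comap_measurable (fun ω => (D.SOA t ω, D.OA (t - 1) ω)))).comap_le

/-- The Bellman operator contracts, so a bounded solution of the Bellman equation at time `t₀` is
the value of the target policy. -/
theorem Covered.ae_eq_qValue_of_bellman (hcov : D.Covered μ M π T t₀)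
    (hgen : D.GeneratedBy μ M T) {b : 𝒮 × 𝒪 × 𝒜 → ℝ} (hb : Measurable b) {B : ℝ}
    (hbB : ∀ᵐ ω ∂μ, |b (D.SOA t₀ ω)| ≤ B)
    (h : ∀ᵐ ω ∂μ, b (D.SOA t₀ ω) - M.meanReward (D.SOA t₀ ω)
        - M.γ * M.nextMean π b (D.SOA t₀ ω) = 0) :
    ∀ᵐ ω ∂μ, b (D.SOA t₀ ω) = M.qValue π (D.SOA t₀ ω) := by
  obtain ⟨c, hc⟩ := M.exists_abs_qValue_le π
  have hq := M.measurable_qValue π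
  -- Sup-norm contraction, iterated almost everywhere: the bound `γⁿ(B + c)` at `t₀` holds after one
  -- step of the target policy by coverage, and the Bellman equations then gain a factor `γ`.
  have hn : ∀ n : ℕ, ∀ᵐ ω ∂μ, |b (D.SOA t₀ ω) - M.qValue π (D.SOA t₀ ω)| ≤
      M.γ ^ n * (B + c) := by
    intro n
    induction n with
    | zero =>
      filter_upwards [hbB] with ω hω
      rw [pow_zero, one_mul]
      exact (abs_sub _ _).trans (add_le_add hω (hc _))
    | succ n ih =>
      have hset : MeasurableSet {x | |b x - M.qValue π x| ≤ M.γ ^ n * (B + c)} :=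
        measurableSet_le (hb.sub hq).abs measurable_const
      filter_upwards [h, hcov.ae_trans_act hgen hset ih hcov.le] with ω h1 h2
      have h3 := M.abs_nextMean_sub_le π hb hq hc h2
      have h4 : b (D.SOA t₀ ω) - M.qValue π (D.SOA t₀ ω) = M.γ *
          (M.nextMean π b (D.SOA t₀ ω) - M.nextMean π (M.qValue π) (D.SOA t₀ ω)) := by
        rw [M.qValue_eq_nextMean π (D.SOA t₀ ω)]
        linarith
      rw [h4, abs_mul, abs_of_nonneg M.γ_nonneg, pow_succ', mul_assoc]
      exact mul_le_mul_of_nonneg_left h3 M.γ_nonneg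
  filter_upwards [ae_all_iff.2 hn] with ω hω
  have hlim : Filter.Tendsto (fun n : ℕ => M.γ ^ n * (B + c)) Filter.atTop (nhds 0) := by
    simpa using (tendsto_pow_atTop_nhds_zero_of_lt_one M.γ_nonneg M.γ_lt_one).mul_const (B + c)
  have := ge_of_tendsto' hlim hω
  exact sub_eq_zero.1 (abs_nonpos_iff.1 this)

variable [StandardBorelSpace Ω] [Nonempty Ω] [StandardBorelSpace 𝒜]

theorem Covered.integrable_residual [StandardBorelSpace 𝒲] (hcov : D.Covered μ M π T t₀)
    (hgen : D.GeneratedBy μ M T) (hreward : D.RewardProxy μ T)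
    {t : ℕ} (ht : t ≤ T) (hQ : Measurable Q) (hint : Integrable (fun ω => Q (D.OWA t₀ ω)) μ) :
    Integrable (fun ω => Q (D.OWA t ω) - D.R t ω - M.γ * policyAverage π Q (D.OW (t + 1) ω)) μ :=
  ((hcov.integrable_OWA hgen hreward hQ hint ht).sub (hgen.integrable_reward ht)).sub
    ((hcov.integrable_policyAverage hgen hreward hQ hint (t := t + 1) (by omega)).const_mul M.γ)

variable [StandardBorelSpace 𝒪]

/-- Completeness in the hidden state. -/
theorem Complete.ae_eq_zero {T : ℕ} (hcomplete : D.Complete μ T) {t : ℕ} (ht1 : 1 ≤ t)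
    (ht : t ≤ T) {h : 𝒮 × 𝒪 × 𝒜 → ℝ} (hm : Measurable h)
    (hL : MemLp (fun ω => h (D.SOA t ω)) 2 μ)
    (h0 : μ[fun ω => h (D.SOA t ω) |
      MeasurableSpace.comap (fun ω => (D.OA (t - 1) ω, D.OA t ω)) inferInstance] =ᵐ[μ] 0) :
    ∀ᵐ ω ∂μ, h (D.SOA t ω) = 0 := by
  have hcomap : MeasurableSpace.comap (fun ω => (D.OA (t - 1) ω, D.OA t ω)) inferInstance =
      MeasurableSpace.comap (fun ω => (D.OA t ω, D.OA (t - 1) ω)) inferInstance :=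
    le_antisymm
      ((measurable_swap.comp (comap_measurable
        (fun ω => (D.OA t ω, D.OA (t - 1) ω)))).comap_le)
      ((measurable_swap.comp (comap_measurable
        (fun ω => (D.OA (t - 1) ω, D.OA t ω)))).comap_le)
  rw [hcomap] at h0
  have hhm : Measurable fun ω => h (D.SOA t ω) := hm.comp (D.measurable_SOA t)
  -- With `k = 0`: the conditional expectation also vanishes within almost every fibre `(o,a)`,
  -- where completeness applies to the section `h(·, o, a)`.
  have hfib := condExp_fibre_ae_eq (D.measurable_OA (t - 1)) (D.measurable_OA t) hhm
    (hL.integrable one_le_two) (k := fun _ => 0) measurable_const h0.symm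
  refine ae_of_ae_ae_fibre (D.measurable_OA t)
    (measurableSet_eq_fun hhm measurable_const) ?_
  filter_upwards [hfib, hcomplete.state t ht1 ht, ae_fibre_eq (D.measurable_OA t),
    (integrable_fibre (D.measurable_OA t) hL.integrable_sq).1] with oa h1 h2 h3 h4
  have heq : (fun ω => h (D.SOA t ω)) =ᵐ[condDistrib id (D.OA t) μ oa]
      fun ω => h (D.S t ω, oa) := by
    filter_upwards [h3] with ω hω
    rw [← hω]
    rfl
  have h5 := (h2 (fun s => h (s, oa)) (by fun_prop) ((memLp_congr_ae heq).1
    ((memLp_two_iff_integrable_sq hhm.aestronglyMeasurable).2 h4))).1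
    ((condExp_congr_ae heq).symm.trans h1.symm)
  exact heq.trans h5

variable [StandardBorelSpace 𝒲]

theorem condExp_OWA_lag (hgen : D.GeneratedBy μ M T) (hreward : D.RewardProxy μ T)
    (haction : D.ActionProxy μ T) {t : ℕ} (ht1 : 1 ≤ t) (ht : t ≤ T) (hQ : Measurable Q)
    (hint : Integrable (fun ω => Q (D.OWA t ω)) μ) :
    μ[fun ω => Q (D.OWA t ω) |
      MeasurableSpace.comap (fun ω => (D.SOA t ω, D.OA (t - 1) ω)) inferInstance] =ᵐ[μ]
      fun ω => M.proxyMean Q (D.SOA t ω) :=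
  (hgen.proxy_lag hreward haction ht1 ht).condExp_ae_eq (D.measurable_SOA_lag t)
    (f := fun z : ((𝒮 × 𝒪 × 𝒜) × 𝒪 × 𝒜) × 𝒲 => Q (z.1.1.2.1, z.2, z.1.1.2.2)) (by fun_prop) hint

/-- Two conditionings: average `W_{t+1}` given the next state and the lagged variables, then average
the next state by the Markov property. -/
theorem Covered.condExp_policyAverage_lag [StandardBorelSpace 𝒮] (hcov : D.Covered μ M π T t₀)
    (hgen : D.GeneratedBy μ M T) (hmarkov : D.Markovian μ T) (hreward : D.RewardProxy μ T)
    {t : ℕ} (ht1 : 1 ≤ t) (ht : t ≤ T) (hQ : Measurable Q)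
    (hint : Integrable (fun ω => Q (D.OWA t₀ ω)) μ) :
    μ[fun ω => policyAverage π Q (D.OW (t + 1) ω) |
      MeasurableSpace.comap (fun ω => (D.SOA t ω, D.OA (t - 1) ω)) inferInstance] =ᵐ[μ]
      fun ω => M.nextMean π (M.proxyMean Q) (D.SOA t ω) := by
  have hV := measurable_policyAverage π hQ
  have hVint := hcov.integrable_policyAverage hgen hreward hQ hint (t := t + 1) (by omega)
  have hX : Measurable (fun ω => ((D.SOA t ω, D.OA (t - 1) ω), D.SO (t + 1) ω)) :=
    (D.measurable_SOA_lag t).prodMk (D.measurable_SO (t + 1))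
  have h1 : μ[fun ω => policyAverage π Q (D.OW (t + 1) ω) | MeasurableSpace.comap
      (fun ω => ((D.SOA t ω, D.OA (t - 1) ω), D.SO (t + 1) ω)) inferInstance] =ᵐ[μ]
      fun ω => ∫ z, M.proxyMean Q z ∂(ConfoundedPOMDP.act π (D.SO (t + 1) ω)) := by
    refine ((hgen.proxy_next ht1 ht).condExp_ae_eq hX
      (f := fun z : (((𝒮 × 𝒪 × 𝒜) × 𝒪 × 𝒜) × 𝒮 × 𝒪) × 𝒲 =>
        policyAverage π Q (z.1.2.2, z.2)) (by fun_prop) hVint).trans ?_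
    exact ae_of_ae_map (D.measurable_SO (t + 1)).aemeasurable
      (hcov.ae_integral_policyAverage hgen hreward hQ hint (by omega))
  have hle : MeasurableSpace.comap (fun ω => (D.SOA t ω, D.OA (t - 1) ω)) inferInstance ≤
      MeasurableSpace.comap (fun ω => ((D.SOA t ω, D.OA (t - 1) ω), D.SO (t + 1) ω))
        inferInstance :=
    (measurable_fst.comp (comap_measurable
      (fun ω => ((D.SOA t ω, D.OA (t - 1) ω), D.SO (t + 1) ω)))).comap_le
  refine (condExp_condExp_of_le hle hX.comap_le).symm.trans ((condExp_congr_ae h1).trans ?_)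
  have hb := ConfoundedPOMDP.measurable_integral_act π (M.measurable_proxyMean hQ)
  exact (hgen.state_lag hmarkov ht1 ht).condExp_ae_eq (D.measurable_SOA_lag t)
    (f := fun z : ((𝒮 × 𝒪 × 𝒜) × 𝒪 × 𝒜) × 𝒮 × 𝒪 =>
      ∫ y, M.proxyMean Q y ∂(ConfoundedPOMDP.act π z.2)) (hb.comp measurable_snd)
    (integrable_condExp.congr h1)

/-- Inserting the hidden state by the tower property replaces each observed term by its kernel mean,
leaving the Bellman residual of `proxyMean Q`. -/
theorem Covered.condExp_residual [StandardBorelSpace 𝒮] (hcov : D.Covered μ M π T t₀)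
    (hgen : D.GeneratedBy μ M T) (hmarkov : D.Markovian μ T) (hreward : D.RewardProxy μ T)
    (haction : D.ActionProxy μ T) {t : ℕ} (ht1 : 1 ≤ t) (ht : t ≤ T) (hQ : Measurable Q)
    (hint : Integrable (fun ω => Q (D.OWA t₀ ω)) μ) :
    μ[fun ω => Q (D.OWA t ω) - D.R t ω - M.γ * policyAverage π Q (D.OW (t + 1) ω) |
      MeasurableSpace.comap (fun ω => (D.OA (t - 1) ω, D.OA t ω)) inferInstance] =ᵐ[μ]
    μ[fun ω => M.proxyMean Q (D.SOA t ω) - M.meanReward (D.SOA t ω)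
        - M.γ * M.nextMean π (M.proxyMean Q) (D.SOA t ω) |
      MeasurableSpace.comap (fun ω => (D.OA (t - 1) ω, D.OA t ω)) inferInstance] := by
  refine (condExp_condExp_of_le (D.comap_OA_lag_le t)
    (D.measurable_SOA_lag t).comap_le).symm.trans (condExp_congr_ae ?_)
  have hQint := hcov.integrable_OWA hgen hreward hQ hint ht
  have hRint := hgen.integrable_reward ht
  have hVint := hcov.integrable_policyAverage hgen hreward hQ hint (t := t + 1) (by omega)
  have hR : μ[D.R t |
      MeasurableSpace.comap (fun ω => (D.SOA t ω, D.OA (t - 1) ω)) inferInstance] =ᵐ[μ]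
      fun ω => M.meanReward (D.SOA t ω) :=
    (hgen.reward_lag haction ht1 ht).condExp_ae_eq (D.measurable_SOA_lag t)
      (f := fun z : ((𝒮 × 𝒪 × 𝒜) × 𝒪 × 𝒜) × ℝ => z.2) measurable_snd hRint
  have h1 := condExp_sub (hQint.sub hRint) (hVint.const_mul M.γ)
    (MeasurableSpace.comap (fun ω => (D.SOA t ω, D.OA (t - 1) ω)) inferInstance)
  have h2 := condExp_sub hQint hRint
    (MeasurableSpace.comap (fun ω => (D.SOA t ω, D.OA (t - 1) ω)) inferInstance)
  have h3 := condExp_smul (μ := μ) M.γ (fun ω => policyAverage π Q (D.OW (t + 1) ω))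
    (MeasurableSpace.comap (fun ω => (D.SOA t ω, D.OA (t - 1) ω)) inferInstance)
  refine h1.trans ?_
  filter_upwards [h2, h3, hR, condExp_OWA_lag hgen hreward haction ht1 ht hQ hQint,
    hcov.condExp_policyAverage_lag hgen hmarkov hreward ht1 ht hQ hint] with ω h2 h3 hR h4 h5
  rw [Pi.sub_apply, h2, Pi.sub_apply, hR, h4]
  congr 1
  refine Eq.trans h3 ?_
  rw [Pi.smul_apply, h5, smul_eq_mul]

/-! ### Existence and uniqueness of bridges -/

/-- The Picard solution satisfies only an observable equation; since the lagged proxy carries no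
information on `W_{t₀}` given `(S_{t₀}, O_{t₀}, A_{t₀})`, that equation concerns `proxyMean Q -
qValue`, and completeness removes the conditioning. -/
theorem exists_bridge (hgen : D.GeneratedBy μ M T) (hreward : D.RewardProxy μ T)
    (haction : D.ActionProxy μ T) (hcomplete : D.Complete μ T) (h1 : 1 ≤ t₀) (hle : t₀ ≤ T)
    (hcompact : ∀ᵐ oa ∂(μ.map (D.OA t₀)), IsCompactOperator (D.bridgeOp μ t₀ oa))
    {B : 𝒪 × 𝒜 → ℝ} (hB : Integrable B (μ.map (D.OA t₀)))
    (hpicard : ∀ᵐ oa ∂(μ.map (D.OA t₀)), ∀ (ι : Type) (σ : ι → ℝ)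
        (u : ι → Lp ℝ 2 ((D.fiber μ t₀ oa).map (D.W t₀)))
        (v : ι → Lp ℝ 2 ((D.fiber μ t₀ oa).map (D.OA (t₀ - 1)))),
        IsSingularSystem (D.bridgeOp μ t₀ oa) σ u v →
          Summable (fun i => (D.targetCoeff μ M π t₀ oa (v i) / σ i) ^ 2) ∧
          ∑' i, (D.targetCoeff μ M π t₀ oa (v i) / σ i) ^ 2 ≤ B oa) :
    ∃ Q : 𝒪 × 𝒲 × 𝒜 → ℝ, Measurable Q ∧ MemLp (fun ω => Q (D.OWA t₀ ω)) 2 μ ∧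
      ∀ᵐ ω ∂μ, M.proxyMean Q (D.SOA t₀ ω) = M.qValue π (D.SOA t₀ ω) := by
  obtain ⟨c, hc⟩ := M.exists_abs_qValue_le π
  have hq := M.measurable_qValue π
  obtain ⟨f, hf, hfL, hf0⟩ := exists_condExp_sub_eq_zero (μ := μ) (D.measurable_S t₀)
    (D.measurable_OA t₀) (D.measurable_W t₀) (D.measurable_OA (t₀ - 1)) hq hc hB (by
      filter_upwards [hcompact, hpicard, hcomplete.proxy t₀ h1 hle] with oa h2 h3 h4
      have : IsProbabilityMeasure (D.fiber μ t₀ oa) := by unfold fiber; infer_instance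
      exact sq_integral_mul_le_of_picard (τ := D.fiber μ t₀ oa) (D.measurable_S t₀)
        (D.measurable_W t₀) (D.measurable_OA (t₀ - 1)) (ψ := fun s => M.qValue π (s, oa))
        (hq.comp measurable_prodMk_right) (fun s => hc _) h2
        (fun g hg hgL => (h4 g hg hgL).1) h3)
  have hQ : Measurable fun x : 𝒪 × 𝒲 × 𝒜 => f ((x.1, x.2.2), x.2.1) := by fun_prop
  have hQL : MemLp (fun ω => (fun x : 𝒪 × 𝒲 × 𝒜 => f ((x.1, x.2.2), x.2.1)) (D.OWA t₀ ω)) 2 μ :=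
    hfL
  set Q : 𝒪 × 𝒲 × 𝒜 → ℝ := fun x => f ((x.1, x.2.2), x.2.1) with hQdef
  refine ⟨Q, hQ, hQL, ?_⟩
  have hb := M.measurable_proxyMean hQ
  have hlag := condExp_OWA_lag hgen hreward haction h1 hle hQ (hQL.integrable one_le_two)
  have hqint : Integrable (fun ω => M.qValue π (D.SOA t₀ ω)) μ :=
    integrable_of_forall_abs_le (hq.comp (D.measurable_SOA t₀)) fun ω => hc _
  have hqL : MemLp (fun ω => M.qValue π (D.SOA t₀ ω)) 2 μ :=
    MemLp.of_bound (hq.comp (D.measurable_SOA t₀)).aestronglyMeasurable c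
      (Filter.Eventually.of_forall fun ω => hc _)
  -- `proxyMean Q` inherits square-integrability as a conditional expectation of `Q`.
  have hbL : MemLp (fun ω => M.proxyMean Q (D.SOA t₀ ω)) 2 μ :=
    (memLp_congr_ae hlag).1 (hQL.condExp one_le_two)
  have hz := hcomplete.ae_eq_zero h1 hle (h := fun x => M.proxyMean Q x - M.qValue π x)
    (hb.sub hq) (hbL.sub hqL) ?_
  · filter_upwards [hz] with ω hω
    exact sub_eq_zero.1 hω
  · refine Filter.EventuallyEq.trans ?_ hf0
    refine (condExp_sub (hbL.integrable one_le_two) hqint _).trans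
      (Filter.EventuallyEq.trans ?_ (condExp_sub (hQL.integrable one_le_two) hqint _).symm)
    have h2 := (condExp_congr_ae (m := MeasurableSpace.comap
      (fun ω => (D.OA (t₀ - 1) ω, D.OA t₀ ω)) inferInstance) hlag).symm.trans
      (condExp_condExp_of_le (D.comap_OA_lag_le t₀) (D.measurable_SOA_lag t₀).comap_le)
    exact h2.sub (Filter.EventuallyEq.refl _ _)

theorem Covered.solvesMomentEquation [StandardBorelSpace 𝒮] (hcov : D.Covered μ M π T t₀)
    (hgen : D.GeneratedBy μ M T) (hmarkov : D.Markovian μ T) (hreward : D.RewardProxy μ T)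
    (haction : D.ActionProxy μ T) (hQ : Measurable Q)
    (hint : Integrable (fun ω => Q (D.OWA t₀ ω)) μ)
    (h : ∀ᵐ ω ∂μ, M.proxyMean Q (D.SOA t₀ ω) = M.qValue π (D.SOA t₀ ω)) :
    D.SolvesMomentEquation μ M.γ T Q (policyAverage π Q) := by
  have hset : MeasurableSet {x | M.proxyMean Q x = M.qValue π x} :=
    measurableSet_eq_fun (M.measurable_proxyMean hQ) (M.measurable_qValue π)
  intro t ht1 ht
  refine ⟨hcov.integrable_residual hgen hreward ht hQ hint,
    (hcov.condExp_residual hgen hmarkov hreward haction ht1 ht hQ hint).trans ?_⟩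
  have h0 : (fun ω => M.proxyMean Q (D.SOA t ω) - M.meanReward (D.SOA t ω)
        - M.γ * M.nextMean π (M.proxyMean Q) (D.SOA t ω)) =ᵐ[μ] 0 := by
    filter_upwards [hcov.ae_SOA hgen hset h ht, hcov.ae_trans_act hgen hset h ht] with ω h1 h2
    have h3 : M.nextMean π (M.proxyMean Q) (D.SOA t ω) =
        M.nextMean π (M.qValue π) (D.SOA t ω) :=
      integral_congr_ae (h2.mono fun y hy => integral_congr_ae hy)
    rw [h1, h3, M.qValue_eq_nextMean, Pi.zero_apply]
    ring
  refine (condExp_congr_ae h0).trans ?_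
  rw [condExp_zero]

/-- Completeness turns the moment equation into a pointwise Bellman equation for `proxyMean Q`, and
the contraction identifies its bounded solution. The bound `B` also puts the residual in `L²`, as
completeness requires. -/
theorem Covered.ae_proxyMean_eq_qValue [StandardBorelSpace 𝒮] (hcov : D.Covered μ M π T t₀)
    (hgen : D.GeneratedBy μ M T) (hmarkov : D.Markovian μ T) (hreward : D.RewardProxy μ T)
    (haction : D.ActionProxy μ T) (hcomplete : D.Complete μ T) (h1 : 1 ≤ t₀)
    (hQ : Measurable Q) (hL : MemLp (fun ω => Q (D.OWA t₀ ω)) 2 μ) {B : ℝ}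
    (hB : ∀ᵐ ω ∂μ, |(μ[fun ω' => Q (D.OWA t₀ ω') |
      MeasurableSpace.comap (D.SOA t₀) inferInstance]) ω| ≤ B)
    (hmoment : D.SolvesMomentEquation μ M.γ T Q (policyAverage π Q)) :
    ∀ᵐ ω ∂μ, M.proxyMean Q (D.SOA t₀ ω) = M.qValue π (D.SOA t₀ ω) := by
  have hint := hL.integrable one_le_two
  have hb := M.measurable_proxyMean hQ
  have hbB : ∀ᵐ ω ∂μ, |M.proxyMean Q (D.SOA t₀ ω)| ≤ B := by
    filter_upwards [hB, condExp_OWA hgen hreward hcov.le hQ hint] with ω h2 h3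
    rwa [← h3]
  refine hcov.ae_eq_qValue_of_bellman hgen hb hbB ?_
  obtain ⟨c, -, hr, -⟩ := M.exists_abs_meanReward_le π
  -- The bound is known only along the data at `t₀`; coverage extends it to the next state with an
  -- action from `π`.
  have hN : ∀ᵐ ω ∂μ, |M.nextMean π (M.proxyMean Q) (D.SOA t₀ ω)| ≤ B := by
    have hset : MeasurableSet {x | |M.proxyMean Q x| ≤ B} := measurableSet_le hb.abs measurable_const
    filter_upwards [hcov.ae_trans_act hgen hset hbB hcov.le] with ω hω
    exact abs_integral_le_of_ae_abs_le (hω.mono fun y hy => abs_integral_le_of_ae_abs_le hy)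
  have hm : Measurable fun x => M.proxyMean Q x - M.meanReward x
      - M.γ * M.nextMean π (M.proxyMean Q) x :=
    (hb.sub M.measurable_meanReward).sub ((M.measurable_nextMean π hb).const_mul _)
  refine hcomplete.ae_eq_zero h1 hcov.le hm ?_ ?_
  · refine MemLp.of_bound (hm.comp (D.measurable_SOA t₀)).aestronglyMeasurable
      (B + c + M.γ * B) ?_
    filter_upwards [hbB, hN] with ω h2 h3
    refine (abs_sub _ _).trans (add_le_add ((abs_sub _ _).trans (add_le_add h2 (hr _))) ?_)
    rw [abs_mul, abs_of_nonneg M.γ_nonneg]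
    exact mul_le_mul_of_nonneg_left h3 M.γ_nonneg
  · exact (hcov.condExp_residual hgen hmarkov hreward haction h1 hcov.le hQ hint).symm.trans
      (hmoment t₀ h1 hcov.le).2

end DataProcess

end

/-! ### The identification theorem -/

theorem theorem1 {Ω 𝒮 𝒪 𝒲 𝒜 : Type*}
    [MeasurableSpace Ω] [StandardBorelSpace Ω] [Nonempty Ω]
    [MeasurableSpace 𝒮] [StandardBorelSpace 𝒮] [MeasurableSpace 𝒪] [StandardBorelSpace 𝒪]
    [MeasurableSpace 𝒲] [StandardBorelSpace 𝒲] [MeasurableSpace 𝒜] [StandardBorelSpace 𝒜]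
    (μ : Measure Ω) [IsProbabilityMeasure μ]
    (M : ConfoundedPOMDP 𝒮 𝒪 𝒲 𝒜) (D : DataProcess Ω 𝒮 𝒪 𝒲 𝒜) (T : ℕ)
    (π : Kernel 𝒪 𝒜) [IsMarkovKernel π]
    (hgen : D.GeneratedBy μ M T)
    (hmarkov : D.Markovian μ T)
    (hreward : D.RewardProxy μ T)
    (haction : D.ActionProxy μ T)
    (hcomplete : D.Complete μ T)
    (hregular : D.Regular μ M π T) :
    -- bridges exist, and some pair of them solves the moment equation
    (∃ (Q : 𝒪 × 𝒲 × 𝒜 → ℝ) (V : 𝒪 × 𝒲 → ℝ),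
      D.IsQBridge μ M π T Q ∧ D.IsVBridge μ M π T V ∧ V = policyAverage π Q ∧
      (∀ t ≤ T, MemLp (fun ω => Q (D.O t ω, D.W t ω, D.A t ω)) 2 μ) ∧
      D.SolvesMomentEquation μ M.γ T Q V) ∧
    -- every `V`-bridge identifies the policy value
    (∀ V : 𝒪 × 𝒲 → ℝ, D.IsVBridge μ M π T V →
      D.policyValue μ M π = ∫ ω, V (D.O 0 ω, D.W 0 ω) ∂μ) ∧
    -- solving the moment equation yields bridges
    (∀ Q : 𝒪 × 𝒲 × 𝒜 → ℝ, Measurable Q →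
      (∀ t ≤ T, MemLp (fun ω => Q (D.O t ω, D.W t ω, D.A t ω)) 2 μ) →
      (∃ B : ℝ, ∀ t, 1 ≤ t → t ≤ T → ∀ᵐ ω ∂μ,
        |(μ[fun ω' => Q (D.O t ω', D.W t ω', D.A t ω') |
          MeasurableSpace.comap (D.SOA t) inferInstance]) ω| ≤ B) →
      D.SolvesMomentEquation μ M.γ T Q (policyAverage π Q) →
      D.IsQBridge μ M π T Q ∧ D.IsVBridge μ M π T (policyAverage π Q)) := by
  obtain ⟨t₀, h1, hle, hstate, hpolicy, hcompact, B, hB, hpicard⟩ := hregular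
  have hcov : D.Covered μ M π T t₀ := ⟨hle, hstate, hpolicy⟩
  refine ⟨?_, ?_, ?_⟩
  · obtain ⟨Q, hQ, hQL, hQq⟩ := DataProcess.exists_bridge hgen hreward haction hcomplete h1 hle
      hcompact hB hpicard
    have hint := hQL.integrable one_le_two
    obtain ⟨hQb, hVb⟩ := hcov.isBridge hgen hreward hQ hint hQq
    exact ⟨Q, policyAverage π Q, hQb, hVb, rfl,
      fun t ht => hcov.memLp_OWA hgen hreward hQ hQL ht,
      hcov.solvesMomentEquation hgen hmarkov hreward haction hQ hint hQq⟩
  · intro V hV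
    obtain ⟨-, hV0⟩ := hV.2 0 (by omega)
    rw [DataProcess.policyValue, ← integral_congr_ae hV0,
      integral_condExp (D.measurable_SO 0).comap_le]
  · rintro Q hQ hQL ⟨C, hC⟩ hmoment
    have hL := hQL t₀ hle
    exact hcov.isBridge hgen hreward hQ (hL.integrable one_le_two)
      (hcov.ae_proxyMean_eq_qValue hgen hmarkov hreward haction hcomplete h1 hQ hL
        (hC t₀ h1 hle) hmoment)
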